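/- **Setting.** Let $n\ge 1$ and $Y=\lambda^\star u^\star {u^\star}^\top+W\in\mathbb R^{n\times n}$, where $\lambda^\star\in\mathbb R\setminus\{0\}$, $u^\star\in\mathbb R^n$ is a unit vector ($\|u^\star\|_2=1$), and $W$ is a symmetric random matrix whose entries on and above the diagonal are independent, symmetric about zero, of common variance $\sigma^2$ ($\sigma\ge 0$), and subgaussian with common parameter $\nu$, i.e. $\mathbb E e^{tW_{ij}}\le e^{\nu t^2/2}$ for all $t\in\mathbb R$. Put $L=\log(2n)/\log\log n$ and $$\mathcal A=\{(\log n)^{-1/2},(\log n)^{-2/2},\dots,(\log n)^{-(\lceil L\rceil-1)/2},(\log n)^{-L/2}\},$$ and $d_\infty(x,y)=\min\{\|y-x\|_\infty,\|y+x\|_\infty\}$. **Algorithm.** Input: $Y$, the noise level $\sigma$, a real number $\widehat\lambda$ (an estimate of $\lambda^\star$), and $\beta>0$. 1. If $\widehat\lambda<0$, replace $(Y,\widehat\lambda)$ by $(-Y,-\widehat\lambda)$. Let $u$ be a unit eigenvector of $Y$ for its largest eigenvalue. 2. Pick any $\widehat\alpha\in\mathcal A$ such that $\widehat I=\{i:|u_i|\ge\widehat\alpha\}$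 satisfies $|\widehat I|\ge 1/(\widehat\alpha^2\log^2 n)$ and $\{i:(1-\beta)\widehat\alpha<|u_i|<(1+\beta)\widehat\alpha\}=\emptyset$. 3. Let $Q$ be the diagonal matrix with $Q_{kk}=\operatorname{sgn}(u_k)$ for $k\in\widehat I$ and $Q_{kk}=1$ otherwise, and let $\widetilde Y=QYQ$. 4. Let $\widehat S=\big(\sum_{j,k\in\widehat I}\widetilde Y_{jk}\big)^{1/2}$ and $\widehat v_j=\big(\sum_{k\in\widehat I}\widetilde Y_{jk}\big)/(\widehat S\sqrt{\widehat\lambda})$ for all $j$. 5. Output $\widehat u$, where $\widehat u_j=u_j$ if $|u_j|\le(\sigma/\widehat\lambda)\log n$, and $\widehat u_j=Q_{jj}\widehat v_j$ otherwise. **Theorem.** For every $C_2>0$ there is a constant $C>0$, depending only on $C_2$, such that for all $0<\epsilon_0\le1$, $C_1>2400/\epsilon_0$ and $K>0$ there are $K'>0$ and $n_0$, depending only on $C_2,\epsilon_0,C_1,K$, for which the following holds. Let $n\ge n_0$ and let the setting above satisfy (i) there is an $\alpha_0\in\mathcal A$ with $\frac1{\alpha_0^2}\ge|\{i:|u^\star_i|\ge\alpha_0\}|>\frac1{\alpha_0^2\log^2n}$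 and $\{i:|u^\star_i|\in[(1-\epsilon_0)\alpha_0,(1+\epsilon_0)\alpha_0]\}=\emptyset$; (ii) $|\lambda^\star|\ge C_1\sqrt{\nu n\log n}$; (iii) $\widehat\lambda$ is a random real number (it may depend on $Y$) such that $|\widehat\lambda-\lambda^\star|\le C_2\sqrt\nu\,(\log n)^{5/2}$ with probability at least $1-Kn^{-8}\log n$. Then with probability at least $1-K'n^{-8}\log n$ the algorithm with $\beta=\epsilon_0/2$ runs through ($\widehat\lambda\ne0$, a threshold as required in step 2 exists, and the sum under the root in step 4 is positive), and for every choice of $u$ in step 1 and of $\widehat\alpha$ in step 2 its output satisfies $$d_\infty(\widehat u,u^\star)\le\frac{C\sqrt\nu\,(\log n)^{5/2}}{|\lambda^\star|}.$$ In particular, the bound does not depend on the coherence $\mu=n\|u^\star\|_\infty^2$. -/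

import Mathlib

open MeasureTheory ProbabilityTheory
open scoped NNReal ENNReal Matrix

namespace SpikedMatrix

noncomputable section

/-- `L = log (2n) / log log n`. -/
def levelExponent (n : ℕ) : ℝ :=
  Real.log (2 * n) / Real.log (Real.log n)

/-- The candidate thresholds
`{(log n)^(-1/2), (log n)^(-2/2), …, (log n)^(-(⌈L⌉ - 1)/2), (log n)^(-L/2)}`. -/
def levels (n : ℕ) : Set ℝ :=
  {a | (∃ k : ℕ, 1 ≤ k ∧ k < ⌈levelExponent n⌉₊ ∧ a = Real.log n ^ (-(k : ℝ) / 2)) ∨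
    a = Real.log n ^ (-levelExponent n / 2)}

variable {n : ℕ}

/-- The indices of the entries that are at least `a` in absolute value. -/
def largeEntries (v : Fin n → ℝ) (a : ℝ) : Finset (Fin n) :=
  Finset.univ.filter fun i => a ≤ |v i|

/-- `v` lies on the Euclidean unit sphere (the ambient norm of `Fin n → ℝ` is the sup norm). -/
def IsUnitVector (v : Fin n → ℝ) : Prop :=
  ∑ i, v i ^ 2 = 1

/-- The entry-gap condition: at some candidate threshold `a`, the number of entries of absolute
value at least `a` is at most `1/a²` and more than `1/(a² log² n)`, and no entry has absolute value
in `[(1-ε)a, (1+ε)a]`. -/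
def HasEntryGap (ε : ℝ) (v : Fin n → ℝ) : Prop :=
  ∃ a ∈ levels n,
    ((largeEntries v a).card : ℝ) ≤ 1 / a ^ 2 ∧
    1 / (a ^ 2 * Real.log n ^ 2) < ((largeEntries v a).card : ℝ) ∧
    ∀ i, |v i| ∉ Set.Icc ((1 - ε) * a) ((1 + ε) * a)

/-- The noise model: a symmetric random matrix whose entries on and above the diagonal are
independent, symmetric about zero, of variance `σ²` and subgaussian with variance proxy `ν`. -/
structure IsNoise {Ω : Type*} [MeasurableSpace Ω] (P : Measure Ω) (σ : ℝ) (ν : ℝ≥0)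
    (W : Ω → Matrix (Fin n) (Fin n) ℝ) : Prop where
  measurable : ∀ i j, Measurable fun ω => W ω i j
  symm : ∀ ω, (W ω).IsSymm
  indep : iIndepFun (fun (p : {p : Fin n × Fin n // p.1 ≤ p.2}) ω => W ω p.1.1 p.1.2) P
  law_neg : ∀ i j, P.map (fun ω => -W ω i j) = P.map (fun ω => W ω i j)
  variance_eq : ∀ i j, Var[fun ω => W ω i j; P] = σ ^ 2
  subgaussian : ∀ i j, HasSubgaussianMGF (fun ω => W ω i j) ν P

/-- The observation `Y = lam • v vᵀ + W`. -/
def observation (lam : ℝ) (v : Fin n → ℝ) (W : Matrix (Fin n) (Fin n) ℝ) :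
    Matrix (Fin n) (Fin n) ℝ :=
  lam • Matrix.vecMulVec v v + W

/-- The observation, with its sign changed if the eigenvalue estimate `lh` is negative. -/
def orient (Y : Matrix (Fin n) (Fin n) ℝ) (lh : ℝ) : Matrix (Fin n) (Fin n) ℝ :=
  if lh < 0 then -Y else Y

/-- `u` is a unit eigenvector of `A` belonging to the largest eigenvalue of `A`. -/
def IsTopEigenvector (A : Matrix (Fin n) (Fin n) ℝ) (u : Fin n → ℝ) : Prop :=
  IsUnitVector u ∧ ∃ t : ℝ, Module.End.HasEigenvector (Matrix.toLin' A) t u ∧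
    ∀ s : ℝ, Module.End.HasEigenvalue (Matrix.toLin' A) s → s ≤ t

/-- The thresholds that the algorithm may pick, given the top eigenvector `u`. -/
structure IsAdmissible (β : ℝ) (u : Fin n → ℝ) (a : ℝ) : Prop where
  mem : a ∈ levels n
  card_ge : 1 / (a ^ 2 * Real.log n ^ 2) ≤ ((largeEntries u a).card : ℝ)
  gap : ∀ i, |u i| ∉ Set.Ioo ((1 - β) * a) ((1 + β) * a)

/-- The diagonal of `Q`: the sign of `u k` on the selected indices, and `1` elsewhere. -/
def signs (u : Fin n → ℝ) (a : ℝ) (k : Fin n) : ℝ :=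
  if k ∈ largeEntries u a then Real.sign (u k) else 1

/-- The matrix `Q Y Q`, where `Y` is the oriented observation. -/
def conjugated (Y : Matrix (Fin n) (Fin n) ℝ) (lh : ℝ) (u : Fin n → ℝ) (a : ℝ) :
    Matrix (Fin n) (Fin n) ℝ :=
  Matrix.diagonal (signs u a) * orient Y lh * Matrix.diagonal (signs u a)

/-- The sum of the entries of `Q Y Q` over the selected rows and columns; its square root is the
normalization `Ŝ`. -/
def selectedSum (Y : Matrix (Fin n) (Fin n) ℝ) (lh : ℝ) (u : Fin n → ℝ) (a : ℝ) : ℝ :=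
  ∑ j ∈ largeEntries u a, ∑ k ∈ largeEntries u a, conjugated Y lh u a j k

/-- The vector `v̂`. -/
def refined (Y : Matrix (Fin n) (Fin n) ℝ) (lh : ℝ) (u : Fin n → ℝ) (a : ℝ) (j : Fin n) : ℝ :=
  (∑ k ∈ largeEntries u a, conjugated Y lh u a j k) / (√(selectedSum Y lh u a) * √|lh|)

/-- The output `û` of the algorithm on the input `Y`, `lh`, when it uses the top eigenvector `u`
and the threshold `a`. The sign of `lh` is changed together with that of `Y`, so `|lh|` appears. -/
def output (σ : ℝ) (Y : Matrix (Fin n) (Fin n) ℝ) (lh : ℝ) (u : Fin n → ℝ) (a : ℝ)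
    (j : Fin n) : ℝ :=
  if |u j| ≤ σ / |lh| * Real.log n then u j else signs u a j * refined Y lh u a j

/-- The `ℓ_∞` distance up to a global sign (`‖·‖` is the sup norm on `Fin n → ℝ`). -/
def dInf (x y : Fin n → ℝ) : ℝ :=
  min ‖y - x‖ ‖y + x‖

/-- On the input `Y`, `lh`, `σ`, `β`, the algorithm runs through, and its output is within `r` of
`v`, whatever top eigenvector and whatever admissible threshold it picks. -/
structure RunsWithin (σ β : ℝ) (Y : Matrix (Fin n) (Fin n) ℝ) (lh : ℝ) (v : Fin n → ℝ)
    (r : ℝ) : Prop where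
  estimate_ne_zero : lh ≠ 0
  exists_eigenvector : ∃ u, IsTopEigenvector (orient Y lh) u
  exists_threshold : ∀ u, IsTopEigenvector (orient Y lh) u → ∃ a, IsAdmissible β u a
  selectedSum_pos : ∀ u a, IsTopEigenvector (orient Y lh) u → IsAdmissible β u a →
    0 < selectedSum Y lh u a
  dist_le : ∀ u a, IsTopEigenvector (orient Y lh) u → IsAdmissible β u a →
    dInf (output σ Y lh u a) v ≤ r

end

end SpikedMatrix

/-!
Let `v` be the spike direction and let `λ > 0`, if necessary by replacing `(Y, λ̂)` by `(-Y, -λ̂)`.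
The eigenvalue equation `t u = λ ⟨v, u⟩ v + W u` expands `u` into a multiple of the Neumann series
`∑ₖ (W / t)ᵏ v`. The `j`-th entry of `Wᵏ v` is compared with the product of row `j` of `W` and an
iterate of `v` under the noise with row and column `j` removed; these are independent, so the
product is subgaussian. Hence, with overwhelming probability, for a sign `s` and all `j`,
`|u_j - s v_j| ≤ (ε / 10) |v_j| + O(√(ν log n) / λ)`. All thresholds are at least `1 / √(2n)`, so
this error is small next to each of them, and a gap in the entries of `u` around a threshold
forces `u` and `s v` to have the same large entries there, with the same signs.

Summing the rows of `Y` over these large entries averages out the noise. Their number is known up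
to `log² n`, which makes the relative error `√(ν log n) log² n / λ = √ν (log n)^(5/2) / λ`. An
entry that is left as `u_j` satisfies `|v_j| = O(σ log n / λ + √(ν log n) / λ)`, and for such `j`
the entrywise bound above is already of the required order.
-/

namespace SpikedMatrix

local notation "‖" x "‖₂" => ‖WithLp.toLp 2 x‖

section LinearAlgebra

open scoped Matrix.Norms.L2Operator

variable {ι : Type*}

section

variable [DecidableEq ι]

lemma sub_update_zero (x : ι → ℝ) (j : ι) : x - Function.update x j 0 = Pi.single j (x j) := by
  ext i
  by_cases h : i = j
  · subst h; simp
  · simp [h]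

/-- The leave-one-out matrix: `W` with its `j`-th row and its `j`-th column set to zero. -/
def leaveOut (W : Matrix ι ι ℝ) (j : ι) : Matrix ι ι ℝ :=
  Matrix.of fun i k => if i = j ∨ k = j then 0 else W i k

lemma leaveOut_smul (a : ℝ) (W : Matrix ι ι ℝ) (j : ι) :
    leaveOut (a • W) j = a • leaveOut W j := by
  ext i k
  simp [leaveOut]

end

variable [Fintype ι]

lemma abs_apply_le_l2_norm (x : ι → ℝ) (i : ι) : |x i| ≤ ‖x‖₂ :=
  PiLp.norm_apply_le (WithLp.toLp 2 x) i

lemma abs_dotProduct_le (x y : ι → ℝ) : |x ⬝ᵥ y| ≤ ‖x‖₂ * ‖y‖₂ := by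
  have h := abs_real_inner_le_norm (WithLp.toLp 2 y) (WithLp.toLp 2 x)
  rwa [EuclideanSpace.inner_toLp_toLp, star_trivial, mul_comm] at h

lemma dotProduct_self_eq_l2_norm_sq (x : ι → ℝ) : x ⬝ᵥ x = ‖x‖₂ ^ 2 := by
  rw [EuclideanSpace.real_norm_sq_eq]
  exact Finset.sum_congr rfl fun i _ => (sq (x i)).symm

variable [DecidableEq ι]

lemma l2_norm_single (i : ι) (a : ℝ) : ‖(Pi.single i a : ι → ℝ)‖₂ = |a| :=
  PiLp.norm_single 2 (fun _ => ℝ) i a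

lemma l2_norm_mulVec_le {W : Matrix ι ι ℝ} {r : ℝ} (hW : ‖W‖ ≤ r) (x : ι → ℝ) :
    ‖W *ᵥ x‖₂ ≤ r * ‖x‖₂ :=
  (Matrix.l2_opNorm_mulVec W (WithLp.toLp 2 x)).trans (by gcongr)

lemma l2_norm_pow_mulVec_le {W : Matrix ι ι ℝ} {r : ℝ} (hW : ‖W‖ ≤ r) (x : ι → ℝ) (k : ℕ) :
    ‖W ^ k *ᵥ x‖₂ ≤ r ^ k * ‖x‖₂ := by
  induction k with
  | zero => simp
  | succ k ih =>
    have hr : 0 ≤ r := (norm_nonneg W).trans hW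
    rw [pow_succ', ← Matrix.mulVec_mulVec, pow_succ', mul_assoc]
    exact (l2_norm_mulVec_le hW _).trans (by gcongr)

lemma l2_norm_update_zero_le (x : ι → ℝ) (j : ι) : ‖Function.update x j 0‖₂ ≤ ‖x‖₂ := by
  rw [EuclideanSpace.norm_eq, EuclideanSpace.norm_eq]
  gcongr with i
  by_cases h : i = j <;> simp [h]

/-- The leave-one-out counterpart of `W ^ k *ᵥ v`. It does not involve the `j`-th row of `W`, so
for a random `W` it is independent of that row. -/
def leaveOutIterate (W : Matrix ι ι ℝ) (v : ι → ℝ) (j : ι) (k : ℕ) : ι → ℝ :=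
  leaveOut W j ^ k *ᵥ Function.update v j 0

lemma leaveOutIterate_smul (a : ℝ) (W : Matrix ι ι ℝ) (v : ι → ℝ) (j : ι) (k : ℕ) :
    leaveOutIterate (a • W) v j k = a ^ k • leaveOutIterate W v j k := by
  rw [leaveOutIterate, leaveOut_smul, smul_pow, Matrix.smul_mulVec, leaveOutIterate]

lemma leaveOut_mulVec_of_apply_eq_zero (W : Matrix ι ι ℝ) {j : ι} {x : ι → ℝ} (hx : x j = 0) :
    leaveOut W j *ᵥ x = Function.update (W *ᵥ x) j 0 := by
  ext i
  by_cases hi : i = j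
  · simp [leaveOut, Matrix.mulVec, dotProduct, hi]
  · simp only [leaveOut, Matrix.mulVec, dotProduct, Matrix.of_apply, hi, false_or, ne_eq,
      not_false_eq_true, Function.update_of_ne]
    refine Finset.sum_congr rfl fun k _ => ?_
    by_cases hk : k = j <;> simp [hk, hx]

lemma leaveOutIterate_apply_self (W : Matrix ι ι ℝ) (v : ι → ℝ) (j : ι) (k : ℕ) :
    leaveOutIterate W v j k j = 0 := by
  cases k with
  | zero => simp [leaveOutIterate]
  | succ k =>
    rw [leaveOutIterate, pow_succ', ← Matrix.mulVec_mulVec]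
    simp [leaveOut, Matrix.mulVec, dotProduct]

lemma leaveOutIterate_succ (W : Matrix ι ι ℝ) (v : ι → ℝ) (j : ι) (k : ℕ) :
    leaveOutIterate W v j (k + 1) = Function.update (W *ᵥ leaveOutIterate W v j k) j 0 := by
  rw [← leaveOut_mulVec_of_apply_eq_zero W (leaveOutIterate_apply_self W v j k), leaveOutIterate,
    leaveOutIterate, pow_succ', ← Matrix.mulVec_mulVec]

lemma l2_norm_leaveOutIterate_le {W : Matrix ι ι ℝ} {r : ℝ} (hW : ‖W‖ ≤ r) (v : ι → ℝ) (j : ι)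
    (k : ℕ) : ‖leaveOutIterate W v j k‖₂ ≤ r ^ k * ‖v‖₂ := by
  induction k with
  | zero => simpa [leaveOutIterate] using l2_norm_update_zero_le v j
  | succ k ih =>
    have hr : 0 ≤ r := (norm_nonneg W).trans hW
    rw [leaveOutIterate_succ, pow_succ', mul_assoc]
    exact (l2_norm_update_zero_le _ _).trans ((l2_norm_mulVec_le hW _).trans (by gcongr))

lemma l2_norm_pow_mulVec_sub_leaveOutIterate_le {W : Matrix ι ι ℝ} {r c : ℝ} (hW : ‖W‖ ≤ r)
    (hc : 0 ≤ c) (v : ι → ℝ) (j : ι) {m : ℕ}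
    (hloo : ∀ k < m, |(W *ᵥ leaveOutIterate W v j k) j| ≤ c * ‖leaveOutIterate W v j k‖₂) :
    ∀ k ≤ m, ‖W ^ k *ᵥ v - leaveOutIterate W v j k‖₂ ≤
      r ^ k * |v j| + k * r ^ (k - 1) * c * ‖v‖₂ := by
  intro k
  induction k with
  | zero => simp [leaveOutIterate, sub_update_zero]
  | succ k ih =>
    intro hk
    have hr : 0 ≤ r := (norm_nonneg W).trans hW
    set b := leaveOutIterate W v j k with hb
    have hsplit : W ^ (k + 1) *ᵥ v - leaveOutIterate W v j (k + 1) =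
        W *ᵥ (W ^ k *ᵥ v - b) + Pi.single j ((W *ᵥ b) j) := by
      rw [leaveOutIterate_succ, ← sub_update_zero, Matrix.mulVec_sub, Matrix.mulVec_mulVec,
        ← pow_succ']
      abel
    have hentry : |(W *ᵥ b) j| ≤ c * (r ^ k * ‖v‖₂) :=
      (hloo k hk).trans (by gcongr; exact l2_norm_leaveOutIterate_le hW v j k)
    have hpow : r * (k * r ^ (k - 1)) = k * r ^ k := by
      cases k with
      | zero => simp
      | succ k => rw [Nat.add_sub_cancel, pow_succ]; ring
    rw [hsplit, WithLp.toLp_add]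
    calc _ ≤ ‖W *ᵥ (W ^ k *ᵥ v - b)‖₂ + |(W *ᵥ b) j| :=
          (norm_add_le _ _).trans_eq (by rw [l2_norm_single])
      _ ≤ r * (r ^ k * |v j| + k * r ^ (k - 1) * c * ‖v‖₂) + c * (r ^ k * ‖v‖₂) := by
          refine add_le_add ((l2_norm_mulVec_le hW _).trans ?_) hentry
          gcongr
          exact ih (by lia)
      _ = r ^ (k + 1) * |v j| + (r * (k * r ^ (k - 1))) * c * ‖v‖₂ + c * (r ^ k * ‖v‖₂) := by ring
      _ = _ := by rw [hpow, Nat.add_sub_cancel]; push_cast; ring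

lemma abs_pow_mulVec_apply_le {W : Matrix ι ι ℝ} {r c : ℝ} (hW : ‖W‖ ≤ r) (hc : 0 ≤ c)
    (v : ι → ℝ) (j : ι) {m : ℕ}
    (hloo : ∀ k < m, |(W *ᵥ leaveOutIterate W v j k) j| ≤ c * ‖leaveOutIterate W v j k‖₂)
    {k : ℕ} (hk : k < m) :
    |(W ^ (k + 1) *ᵥ v) j| ≤ r ^ (k + 1) * |v j| + (k + 1) * r ^ k * c * ‖v‖₂ := by
  have h := l2_norm_pow_mulVec_sub_leaveOutIterate_le hW hc v j hloo (k + 1) hk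
  rw [Nat.add_sub_cancel, Nat.cast_add_one] at h
  refine le_trans ?_ h
  simpa [leaveOutIterate_apply_self] using
    abs_apply_le_l2_norm (W ^ (k + 1) *ᵥ v - leaveOutIterate W v j (k + 1)) j

lemma eq_neumann_sum_add {N : Matrix ι ι ℝ} {u v : ι → ℝ} {q : ℝ} (h : u = q • v + N *ᵥ u)
    (m : ℕ) :
    u = q • v + q • ∑ k ∈ Finset.range m, N ^ (k + 1) *ᵥ v + N ^ (m + 1) *ᵥ u := by
  induction m with
  | zero => simpa using h
  | succ m ih =>
    have hstep : N ^ (m + 1) *ᵥ u = q • N ^ (m + 1) *ᵥ v + N ^ (m + 1 + 1) *ᵥ u := by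
      conv_lhs => rw [h]
      rw [Matrix.mulVec_add, Matrix.mulVec_smul, Matrix.mulVec_mulVec, ← pow_succ]
    rw [Finset.sum_range_succ, smul_add]
    conv_lhs => rw [ih, hstep]
    abel

lemma sum_pow_succ_le {r : ℝ} (hr₀ : 0 ≤ r) (hr₁ : r < 1) (m : ℕ) :
    ∑ k ∈ Finset.range m, r ^ (k + 1) ≤ r / (1 - r) := by
  have h := (hasSum_geometric_of_lt_one hr₀ hr₁).mul_left r
  simp only [← pow_succ'] at h
  exact sum_le_hasSum _ (fun k _ => by positivity) h

lemma sum_succ_mul_pow_le {r : ℝ} (hr₀ : 0 ≤ r) (hr₁ : r < 1) (m : ℕ) :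
    ∑ k ∈ Finset.range m, ((k : ℝ) + 1) * r ^ k ≤ 1 / (1 - r) ^ 2 := by
  have h := hasSum_choose_mul_geometric_of_norm_lt_one 1 (r := r)
    (by rwa [Real.norm_of_nonneg hr₀])
  simp only [Nat.choose_one_right, Nat.cast_add_one] at h
  exact sum_le_hasSum _ (fun k _ => by positivity) h

lemma abs_sum_pow_mulVec_apply_le {N : Matrix ι ι ℝ} {r c : ℝ} (hN : ‖N‖ ≤ r) (hr : r < 1)
    (hc : 0 ≤ c) (v : ι → ℝ) (j : ι) {m : ℕ}
    (hloo : ∀ k < m, |(N *ᵥ leaveOutIterate N v j k) j| ≤ c * ‖leaveOutIterate N v j k‖₂) :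
    |∑ k ∈ Finset.range m, (N ^ (k + 1) *ᵥ v) j| ≤
      r / (1 - r) * |v j| + 1 / (1 - r) ^ 2 * (c * ‖v‖₂) := by
  have hr₀ : 0 ≤ r := (norm_nonneg N).trans hN
  calc _ ≤ ∑ k ∈ Finset.range m, |(N ^ (k + 1) *ᵥ v) j| := Finset.abs_sum_le_sum_abs _ _
    _ ≤ ∑ k ∈ Finset.range m, (r ^ (k + 1) * |v j| + (k + 1) * r ^ k * (c * ‖v‖₂)) := by
        refine Finset.sum_le_sum fun k hk => ?_
        rw [← mul_assoc]
        exact abs_pow_mulVec_apply_le hN hc v j hloo (Finset.mem_range.1 hk)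
    _ ≤ _ := by
        rw [Finset.sum_add_distrib, ← Finset.sum_mul, ← Finset.sum_mul]
        gcongr
        exacts [sum_pow_succ_le hr₀ hr m, sum_succ_mul_pow_le hr₀ hr m]

lemma exists_sign_abs_sub_le {q r : ℝ} (h : |(|q| - 1)| ≤ r) :
    ∃ s : ℝ, (s = 1 ∨ s = -1) ∧ |q - s| ≤ r := by
  rcases le_total 0 q with hq | hq
  · exact ⟨1, .inl rfl, by rwa [abs_of_nonneg hq] at h⟩
  · refine ⟨-1, .inr rfl, ?_⟩
    rwa [abs_of_nonpos hq, abs_sub_comm, ← abs_neg, neg_sub, neg_sub_left, abs_neg,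
      add_comm, ← sub_neg_eq_add] at h

lemma exists_sign_abs_apply_sub_le {N : Matrix ι ι ℝ} {u v : ι → ℝ} {q r c : ℝ} {m : ℕ}
    (hN : ‖N‖ ≤ r) (hr : r < 1) (hc : 0 ≤ c) (hu : ‖u‖₂ = 1) (hv : ‖v‖₂ = 1)
    (hfix : u = q • v + N *ᵥ u)
    (hloo : ∀ j, ∀ k < m,
      |(N *ᵥ leaveOutIterate N v j k) j| ≤ c * ‖leaveOutIterate N v j k‖₂) :
    ∃ s : ℝ, (s = 1 ∨ s = -1) ∧ ∀ j, |u j - s * v j| ≤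
      2 * r / (1 - r) * |v j| + (1 + r) / (1 - r) ^ 2 * c + r ^ (m + 1) := by
  have hr₀ : 0 ≤ r := (norm_nonneg N).trans hN
  have hr' : 0 < 1 - r := sub_pos.2 hr
  have hqr : |(|q| - 1)| ≤ r := by
    have h := abs_norm_sub_norm_le (WithLp.toLp 2 (q • v)) (WithLp.toLp 2 u)
    rw [WithLp.toLp_smul, norm_smul, hv, hu, mul_one, Real.norm_eq_abs, ← WithLp.toLp_smul,
      norm_sub_rev, ← WithLp.toLp_sub, sub_eq_of_eq_add' hfix] at h
    exact h.trans (by simpa [hu] using l2_norm_mulVec_le hN u)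
  obtain ⟨s, hs, hqs⟩ := exists_sign_abs_sub_le hqr
  refine ⟨s, hs, fun j => ?_⟩
  set S := ∑ k ∈ Finset.range m, (N ^ (k + 1) *ᵥ v) j
  have hexpand : u j - s * v j = (q - s) * v j + q * S + (N ^ (m + 1) *ᵥ u) j := by
    have h := congrFun (eq_neumann_sum_add hfix m) j
    simp only [Pi.add_apply, Pi.smul_apply, Finset.sum_apply, smul_eq_mul] at h
    rw [h]
    ring
  have hSle : |S| ≤ r / (1 - r) * |v j| + 1 / (1 - r) ^ 2 * c := by
    simpa only [hv, mul_one] using abs_sum_pow_mulVec_apply_le hN hr hc v j (hloo j)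
  have hremainder : |(N ^ (m + 1) *ᵥ u) j| ≤ r ^ (m + 1) :=
    (abs_apply_le_l2_norm _ j).trans (by simpa [hu] using l2_norm_pow_mulVec_le hN u (m + 1))
  have hq : |q| ≤ 1 + r := by linarith [(abs_le.1 hqr).2]
  calc |u j - s * v j| ≤ |q - s| * |v j| + |q| * |S| + |(N ^ (m + 1) *ᵥ u) j| := by
        rw [hexpand, ← abs_mul, ← abs_mul]
        exact abs_add_three _ _ _
    _ ≤ r * |v j| + (1 + r) * (r / (1 - r) * |v j| + 1 / (1 - r) ^ 2 * c) + r ^ (m + 1) := by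
        gcongr
    _ = _ := by field_simp; ring

lemma dotProduct_mulVec_le_of_forall_hasEigenvalue_le {A : Matrix ι ι ℝ} (hA : A.IsHermitian)
    {t : ℝ} (ht : ∀ s : ℝ, Module.End.HasEigenvalue (Matrix.toLin' A) s → s ≤ t) (x : ι → ℝ) :
    x ⬝ᵥ A *ᵥ x ≤ t * (x ⬝ᵥ x) := by
  have hpos : (algebraMap ℝ (Matrix ι ι ℝ) t - A).PosSemidef := by
    refine Matrix.posSemidef_iff_isHermitian_and_spectrum_nonneg.2 ⟨?_, fun a ha => ?_⟩
    · exact (Matrix.isHermitian_diagonal _).sub hA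
    · rw [← spectrum.singleton_sub_eq] at ha
      obtain ⟨_, rfl, s, hs, rfl⟩ := ha
      rw [← Matrix.spectrum_toLin'] at hs
      exact sub_nonneg.2 (ht s (Module.End.hasEigenvalue_iff_mem_spectrum.2 hs))
  have h := hpos.dotProduct_mulVec_nonneg x
  rw [star_trivial, Matrix.sub_mulVec, dotProduct_sub, Algebra.algebraMap_eq_smul_one,
    Matrix.smul_mulVec, Matrix.one_mulVec, dotProduct_smul, smul_eq_mul] at h
  exact sub_nonneg.1 h

lemma IsUnitVector.pos {n : ℕ} {v : Fin n → ℝ} (hv : IsUnitVector v) : 0 < n := by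
  refine Nat.pos_of_ne_zero ?_
  rintro rfl
  simp [IsUnitVector] at hv

lemma IsUnitVector.l2_norm_eq_one {n : ℕ} {v : Fin n → ℝ} (hv : IsUnitVector v) : ‖v‖₂ = 1 := by
  rw [EuclideanSpace.norm_eq, Real.sqrt_eq_one]
  simpa [IsUnitVector] using hv

lemma exists_isTopEigenvector {n : ℕ} (hn : 0 < n) {A : Matrix (Fin n) (Fin n) ℝ}
    (hA : A.IsHermitian) : ∃ u, IsTopEigenvector A u := by
  have : Nonempty (Fin n) := ⟨⟨0, hn⟩⟩
  obtain ⟨i, hi⟩ := Finite.exists_max hA.eigenvalues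
  have hnorm : ‖hA.eigenvectorBasis i‖ = 1 := hA.eigenvectorBasis.orthonormal.1 i
  refine ⟨(hA.eigenvectorBasis i).ofLp, ?_, hA.eigenvalues i, ⟨?_, fun h0 => ?_⟩, fun s hs => ?_⟩
  · rw [IsUnitVector, ← EuclideanSpace.real_norm_sq_eq, hnorm, one_pow]
  · rw [Module.End.mem_eigenspace_iff, Matrix.toLin'_apply]
    exact hA.mulVec_eigenvectorBasis i
  · rw [(WithLp.ofLp_eq_zero 2).1 h0, norm_zero] at hnorm
    exact zero_ne_one hnorm
  · rw [Module.End.hasEigenvalue_iff_mem_spectrum, Matrix.spectrum_toLin',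
      hA.spectrum_real_eq_range_eigenvalues] at hs
    obtain ⟨k, rfl⟩ := hs
    exact hi k

lemma exists_half_net_card_le (E : Type*) [NormedAddCommGroup E] [NormedSpace ℝ E]
    [FiniteDimensional ℝ E] :
    ∃ t : Finset E, t.card ≤ 5 ^ Module.finrank ℝ E ∧ (∀ x ∈ t, ‖x‖ ≤ 1) ∧
      ∀ x : E, ‖x‖ ≤ 1 → ∃ y ∈ t, ‖x - y‖ ≤ 1 / 2 := by
  classical
  obtain ⟨s, hcard, hs, hsep⟩ : Besicovitch.multiplicity E ∈ {N | ∃ s : Finset E, s.card = N ∧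
      (∀ c ∈ s, ‖c‖ ≤ 2) ∧ ∀ c ∈ s, ∀ d ∈ s, c ≠ d → 1 ≤ ‖c - d‖} := by
    refine Nat.sSup_mem ⟨0, ∅, by simp⟩ ⟨5 ^ Module.finrank ℝ E, ?_⟩
    rintro _ ⟨s, rfl, hs, hsep⟩
    exact Besicovitch.card_le_of_separated s hs hsep
  have hdense : ∀ x : E, ‖x‖ ≤ 2 → ∃ y ∈ s, ‖x - y‖ ≤ 1 := by
    intro x hx
    by_contra! hfar
    have hxs : x ∉ s := fun h => by simpa using (hfar x h).trans_le' zero_le_one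
    have h := Besicovitch.card_le_multiplicity (s := insert x s)
      ((Finset.forall_mem_insert _ _ _).2 ⟨hx, hs⟩) (by grind [norm_sub_rev])
    rw [Finset.card_insert_of_notMem hxs] at h
    lia
  refine ⟨s.image fun c => (2 : ℝ)⁻¹ • c, ?_, ?_, fun x hx => ?_⟩
  · exact Finset.card_image_le.trans (hcard.trans_le Besicovitch.multiplicity_le)
  · simp only [Finset.forall_mem_image, norm_smul, norm_inv, Real.norm_ofNat]
    intro c hc
    linarith [hs c hc]
  · obtain ⟨y, hy, hxy⟩ := hdense ((2 : ℝ) • x) (by rw [norm_smul, Real.norm_ofNat]; linarith)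
    refine ⟨_, Finset.mem_image_of_mem _ hy, ?_⟩
    have h : x - (2 : ℝ)⁻¹ • y = (2 : ℝ)⁻¹ • ((2 : ℝ) • x - y) := by
      rw [smul_sub, inv_smul_smul₀ two_ne_zero]
    rw [h, norm_smul, norm_inv, Real.norm_ofNat]
    linarith

lemma opNorm_le_of_half_net {E F : Type*} [NormedAddCommGroup E] [NormedSpace ℝ E]
    [SeminormedAddCommGroup F] [NormedSpace ℝ F] (f : E →L[ℝ] F) {t : Set E} {T : ℝ} (hT : 0 ≤ T)
    (ht : ∀ x : E, ‖x‖ ≤ 1 → ∃ y ∈ t, ‖x - y‖ ≤ 1 / 2) (hf : ∀ y ∈ t, ‖f y‖ ≤ T) :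
    ‖f‖ ≤ 2 * T := by
  suffices h : ‖f‖ ≤ ‖f‖ * (1 / 2) + T by linarith
  refine f.opNorm_le_of_unit_norm (by positivity) fun x hx => ?_
  obtain ⟨y, hy, hxy⟩ := ht x hx.le
  calc ‖f x‖ = ‖f (x - y) + f y‖ := by rw [map_sub, sub_add_cancel]
    _ ≤ ‖f (x - y)‖ + ‖f y‖ := norm_add_le _ _
    _ ≤ ‖f‖ * (1 / 2) + T := add_le_add (f.le_opNorm_of_le hxy) (hf y hy)

lemma l2_opNorm_le_of_half_net {A : Matrix ι ι ℝ} {t : Set (EuclideanSpace ℝ ι)} {T : ℝ}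
    (hT : 0 ≤ T) (ht : ∀ x : EuclideanSpace ℝ ι, ‖x‖ ≤ 1 → ∃ y ∈ t, ‖x - y‖ ≤ 1 / 2)
    (hA : ∀ x ∈ t, ∀ y ∈ t, |x.ofLp ⬝ᵥ A *ᵥ y.ofLp| ≤ T) : ‖A‖ ≤ 4 * T := by
  have hrow : ∀ y ∈ t, ‖A *ᵥ y.ofLp‖₂ ≤ 2 * T := by
    intro y hy
    rw [← innerSL_apply_norm ℝ]
    refine opNorm_le_of_half_net _ hT ht fun x hx => ?_
    rw [innerSL_apply_apply, PiLp.inner_apply]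
    simpa [dotProduct] using hA x hx y hy
  calc ‖A‖ ≤ 2 * (2 * T) := opNorm_le_of_half_net (Matrix.toEuclideanLin A).toContinuousLinearMap
        (by positivity) ht hrow
    _ = 4 * T := by ring

end LinearAlgebra

section Probability

variable {Ω : Type*} [MeasurableSpace Ω] {P : Measure Ω}

lemma measure_not_forall_mem_le {α : Type*} (s : Finset α) {p : α → Ω → Prop} {δ : ℝ}
    (h : ∀ a ∈ s, P {ω | ¬ p a ω} ≤ ENNReal.ofReal δ) :
    P {ω | ¬ ∀ a ∈ s, p a ω} ≤ ENNReal.ofReal (s.card * δ) := by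
  have hunion : {ω | ¬ ∀ a ∈ s, p a ω} = ⋃ a ∈ s, {ω | ¬ p a ω} := by
    ext ω
    simp
  rw [hunion, ENNReal.ofReal_mul (Nat.cast_nonneg _), ENNReal.ofReal_natCast, ← nsmul_eq_mul]
  exact (measure_biUnion_finset_le _ _).trans (Finset.sum_le_card_nsmul _ _ _ h)

lemma measure_not_and_le {p q : Ω → Prop} :
    P {ω | ¬ (p ω ∧ q ω)} ≤ P {ω | ¬ p ω} + P {ω | ¬ q ω} := by
  refine (measure_mono fun ω hω => ?_).trans (measure_union_le _ _)
  exact not_and_or.1 hω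

lemma measure_le_of_indepFun [IsProbabilityMeasure P] {E F : Type*} [MeasurableSpace E]
    [MeasurableSpace F] {X : Ω → E} {Y : Ω → F} (hX : Measurable X) (hY : Measurable Y)
    (hXY : IndepFun X Y P) {s : Set (E × F)} (hs : MeasurableSet s) {δ : ℝ≥0∞}
    (h : ∀ y, P {ω | (X ω, y) ∈ s} ≤ δ) : P {ω | (X ω, Y ω) ∈ s} ≤ δ := by
  have hPY := Measure.isProbabilityMeasure_map (μ := P) hY.aemeasurable
  calc P {ω | (X ω, Y ω) ∈ s} = (P.map X).prod (P.map Y) s := by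
        rw [← (indepFun_iff_map_prod_eq_prod_map_map hX.aemeasurable hY.aemeasurable).1 hXY,
          Measure.map_apply (hX.prodMk hY) hs]
        rfl
    _ = ∫⁻ y, P {ω | (X ω, y) ∈ s} ∂P.map Y := by
        rw [Measure.prod_apply_symm hs]
        exact lintegral_congr fun y => Measure.map_apply hX (measurable_prodMk_right hs)
    _ ≤ ∫⁻ _, δ ∂P.map Y := lintegral_mono h
    _ = δ := by simp

lemma hasSubgaussianMGF_mono {X : Ω → ℝ} {c d : ℝ≥0} (h : HasSubgaussianMGF X c P) (hcd : c ≤ d) :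
    HasSubgaussianMGF X d P where
  integrable_exp_mul := h.integrable_exp_mul
  mgf_le t := (h.mgf_le t).trans (by gcongr)

lemma measure_not_abs_le_of_hasSubgaussianMGF [IsFiniteMeasure P] {X : Ω → ℝ} {c : ℝ≥0}
    (h : HasSubgaussianMGF X c P) {s : ℝ} (hs : 0 ≤ s) :
    P {ω | ¬ |X ω| ≤ √(2 * c * s)} ≤ ENNReal.ofReal (2 * Real.exp (-s)) := by
  rcases eq_or_ne c 0 with rfl | hc
  · have hX : ∀ᵐ ω ∂P, |X ω| ≤ √(2 * (0 : ℝ≥0) * s) :=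
      h.ae_eq_zero_of_hasSubgaussianMGF_zero.mono fun ω hω => by simp [hω]
    exact (ae_iff.1 hX).le.trans zero_le
  · have hexp : -√(2 * c * s) ^ 2 / (2 * c) = -s := by
      rw [Real.sq_sqrt (by positivity)]
      field_simp
    have hpos := h.measure_ge_le (Real.sqrt_nonneg (2 * c * s))
    have hneg := h.neg.measure_ge_le (Real.sqrt_nonneg (2 * c * s))
    rw [hexp] at hpos hneg
    have hsub : {ω | ¬ |X ω| ≤ √(2 * c * s)} ⊆
        {ω | √(2 * c * s) ≤ X ω} ∪ {ω | √(2 * c * s) ≤ (-X) ω} := fun ω hω =>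
      (lt_abs.1 (not_le.1 hω)).imp le_of_lt le_of_lt
    rw [← ofReal_measureReal]
    refine ENNReal.ofReal_le_ofReal ((measureReal_mono hsub).trans ?_)
    linarith [measureReal_union_le (μ := P) {ω | √(2 * c * s) ≤ X ω} {ω | √(2 * c * s) ≤ (-X) ω}]

lemma one_add_sq_div_two_le_cosh (x : ℝ) : 1 + x ^ 2 / 2 ≤ Real.cosh x := by
  have hdouble : Real.cosh x = 1 + 2 * Real.sinh (x / 2) ^ 2 := by
    have h := Real.cosh_two_mul (x / 2)
    rw [mul_div_cancel₀ x two_ne_zero, Real.cosh_sq] at h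
    linarith
  have hsinh : (x / 2) ^ 2 ≤ Real.sinh (x / 2) ^ 2 := by
    rw [sq_le_sq, Real.abs_sinh]
    exact Real.self_le_sinh_iff.2 (abs_nonneg _)
  linarith

lemma sq_mul_integral_sq_le_of_hasSubgaussianMGF [IsProbabilityMeasure P] {X : Ω → ℝ} {c : ℝ≥0}
    (h : HasSubgaussianMGF X c P) (t : ℝ) :
    t ^ 2 * ∫ ω, X ω ^ 2 ∂P ≤ 2 * (Real.exp (c * t ^ 2 / 2) - 1) := by
  have hX := (h.memLp 2).integrable_sq.const_mul (t ^ 2)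
  have hpos := h.integrable_exp_mul t
  have hneg := h.integrable_exp_mul (-t)
  have hint := integral_mono (hX.add (integrable_const (2 : ℝ))) (hpos.add hneg) fun ω => by
    have hcosh := one_add_sq_div_two_le_cosh (t * X ω)
    rw [Real.cosh_eq, ← neg_mul] at hcosh
    simp only [Pi.add_apply]
    linarith
  simp only [Pi.add_apply] at hint
  rw [integral_add hX (integrable_const _), integral_add hpos hneg, integral_const_mul,
    integral_const, probReal_univ, one_smul] at hint
  have hmgf := h.mgf_le t
  have hmgf' := h.mgf_le (-t)
  rw [neg_sq] at hmgf'
  unfold mgf at hmgf hmgf'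
  linarith

lemma le_of_forall_mul_le_exp_sub_one {a c : ℝ}
    (h : ∀ y, 0 < y → y * a ≤ Real.exp (c * y) - 1) : a ≤ c := by
  have hderiv : HasDerivAt (fun y => Real.exp (c * y)) c 0 := by
    simpa using ((hasDerivAt_id (0 : ℝ)).const_mul c).exp
  have hslope := (hasDerivAt_iff_tendsto_slope_zero.1 hderiv).mono_left (nhdsGT_le_nhdsNE 0)
  refine ge_of_tendsto hslope ?_
  filter_upwards [self_mem_nhdsWithin] with y hy
  rw [smul_eq_mul, zero_add, mul_zero, Real.exp_zero, ← div_eq_inv_mul, le_div_iff₀' hy]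
  exact h y hy

lemma variance_le_of_hasSubgaussianMGF [IsProbabilityMeasure P] {X : Ω → ℝ} {c : ℝ≥0}
    (h : HasSubgaussianMGF X c P) : Var[X; P] ≤ c := by
  refine (variance_le_expectation_sq h.aestronglyMeasurable).trans ?_
  refine le_of_forall_mul_le_exp_sub_one fun y hy => ?_
  have hsq := sq_mul_integral_sq_le_of_hasSubgaussianMGF h √(2 * y)
  rw [Real.sq_sqrt (by positivity), mul_left_comm, mul_div_cancel_left₀ _ two_ne_zero] at hsq
  simp only [Pi.pow_apply]
  linarith

end Probability

section Noise

open scoped Matrix.Norms.L2Operator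

variable {n : ℕ} {Ω : Type*} [MeasurableSpace Ω] {P : Measure Ω} {σ : ℝ} {ν : ℝ≥0}
  {W : Ω → Matrix (Fin n) (Fin n) ℝ}

/-- The part of the noise model `IsNoise` that the concentration bounds rest on: a symmetric random
matrix whose entries on and above the diagonal are independent and subgaussian with variance proxy
`ν`, but need neither be symmetric about zero nor have a common variance. -/
structure IsSubgaussianNoise {n : ℕ} {Ω : Type*} [MeasurableSpace Ω] (P : Measure Ω) (ν : ℝ≥0)
    (W : Ω → Matrix (Fin n) (Fin n) ℝ) : Prop where
  measurable : ∀ i j, Measurable fun ω => W ω i j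
  symm : ∀ ω, (W ω).IsSymm
  indep : iIndepFun (fun (p : {p : Fin n × Fin n // p.1 ≤ p.2}) ω => W ω p.1.1 p.1.2) P
  subgaussian : ∀ i j, HasSubgaussianMGF (fun ω => W ω i j) ν P

lemma IsNoise.isSubgaussianNoise (hW : IsNoise P σ ν W) : IsSubgaussianNoise P ν W :=
  ⟨hW.measurable, hW.symm, hW.indep, hW.subgaussian⟩

lemma IsNoise.le_sqrt [IsProbabilityMeasure P] (hn : 0 < n) (hW : IsNoise P σ ν W) :
    σ ≤ √(ν : ℝ) := by
  refine Real.le_sqrt_of_sq_le ?_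
  rw [← hW.variance_eq ⟨0, hn⟩ ⟨0, hn⟩]
  exact variance_le_of_hasSubgaussianMGF (hW.subgaussian _ _)

lemma sum_sum_eq_sum_upper {ι M : Type*} [Fintype ι] [LinearOrder ι] [AddCommMonoid M]
    (f : ι → ι → M) :
    ∑ i, ∑ j, f i j = ∑ p : {p : ι × ι // p.1 ≤ p.2},
      (f p.1.1 p.1.2 + if p.1.1 < p.1.2 then f p.1.2 p.1.1 else 0) := by
  rw [← Finset.sum_subtype (Finset.univ.filter fun p : ι × ι => p.1 ≤ p.2) (by simp)
    (fun p => f p.1 p.2 + if p.1 < p.2 then f p.2 p.1 else 0), Finset.sum_filter,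
    Fintype.sum_prod_type]
  have hsplit : ∀ i j, (if i ≤ j then f i j + if i < j then f j i else 0 else 0) =
      (if i ≤ j then f i j else 0) + if i < j then f j i else 0 := by
    intro i j
    by_cases h : i ≤ j
    · simp [h]
    · simp [h, mt le_of_lt h]
  simp only [hsplit, Finset.sum_add_distrib]
  rw [Finset.sum_comm (f := fun i j => if i < j then f j i else 0)]
  simp only [← Finset.sum_add_distrib]
  refine Finset.sum_congr rfl fun i _ => Finset.sum_congr rfl fun j _ => ?_
  rcases le_or_gt i j with h | h
  · simp [h, h.not_gt]
  · simp [h, h.not_ge]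

namespace IsSubgaussianNoise

lemma hasSubgaussianMGF_sum (hW : IsSubgaussianNoise P ν W) (M : Matrix (Fin n) (Fin n) ℝ) :
    HasSubgaussianMGF (fun ω => ∑ i, ∑ j, M i j * W ω i j)
      (2 * ν * ∑ i, ∑ j, (‖M i j‖₊) ^ 2) P := by
  let a : {p : Fin n × Fin n // p.1 ≤ p.2} → ℝ := fun p =>
    M p.1.1 p.1.2 + if p.1.1 < p.1.2 then M p.1.2 p.1.1 else 0
  have hindep : iIndepFun (fun p ω => a p * W ω p.1.1 p.1.2) P :=
    hW.indep.comp (fun p x => a p * x) fun p => measurable_const_mul (a p)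
  have hsum := HasSubgaussianMGF.sum_of_iIndepFun hindep (s := Finset.univ)
    fun p _ => (hW.subgaussian p.1.1 p.1.2).const_mul (a p)
  refine (hasSubgaussianMGF_mono hsum ?_).congr (.of_forall fun ω => ?_)
  · rw [sum_sum_eq_sum_upper, Finset.mul_sum, ← NNReal.coe_le_coe, NNReal.coe_sum, NNReal.coe_sum]
    refine Finset.sum_le_sum fun p _ => ?_
    have hsq : a p ^ 2 ≤ 2 * (M p.1.1 p.1.2 ^ 2 +
        if p.1.1 < p.1.2 then M p.1.2 p.1.1 ^ 2 else 0) := by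
      simp only [a]
      split_ifs
      · linarith [add_sq_le (a := M p.1.1 p.1.2) (b := M p.1.2 p.1.1)]
      · linarith [sq_nonneg (M p.1.1 p.1.2)]
    refine (mul_le_mul_of_nonneg_right hsq ν.2).trans_eq ?_
    split_ifs <;> simp [mul_right_comm]
  · change _ = ∑ i, ∑ j, M i j * W ω i j
    rw [sum_sum_eq_sum_upper]
    refine Finset.sum_congr rfl fun p _ => ?_
    simp only [a, add_mul, ite_mul, zero_mul, (hW.symm ω).apply p.1.1 p.1.2]

lemma indepFun_row_leaveOut (hW : IsSubgaussianNoise P ν W) (j : Fin n) :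
    IndepFun (fun ω => W ω j) (fun ω i k => leaveOut (W ω) j i k) P := by
  let S : Finset {p : Fin n × Fin n // p.1 ≤ p.2} := {p | p.1.1 = j ∨ p.1.2 = j}
  have hsort : ∀ ω i k, W ω (min i k) (max i k) = W ω i k := fun ω i k => by
    rcases le_total i k with h | h
    · simp [h]
    · simpa [h] using (hW.symm ω).apply i k
  have hS : ∀ i k, ⟨(min i k, max i k), min_le_max⟩ ∈ S ↔ i = j ∨ k = j := fun i k => by
    rcases le_total i k with h | h <;> simp [S, h, or_comm]
  have hindep := hW.indep.indepFun_finset S Sᶜ disjoint_compl_right fun p => hW.measurable _ _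
  let row : (S → ℝ) → Fin n → ℝ := fun f k =>
    f ⟨⟨(min j k, max j k), min_le_max⟩, (hS j k).2 (.inl rfl)⟩
  let rest : ((Sᶜ : Finset _) → ℝ) → Fin n → Fin n → ℝ := fun g i k =>
    if h : i = j ∨ k = j then 0
    else g ⟨⟨(min i k, max i k), min_le_max⟩, Finset.mem_compl.2 (mt (hS i k).1 h)⟩
  have hrow : Measurable row := measurable_pi_lambda _ fun k => measurable_pi_apply _
  have hrest : Measurable rest := by
    refine measurable_pi_lambda _ fun i => measurable_pi_lambda _ fun k => ?_
    by_cases h : i = j ∨ k = j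
    · simp only [rest, h, dif_pos, measurable_const]
    · simp only [rest, h, dif_neg, not_false_eq_true]
      exact measurable_pi_apply _
  convert hindep.comp hrow hrest using 1
  · ext ω k
    exact (hsort ω j k).symm
  · ext ω i k
    simp only [leaveOut, Matrix.of_apply, Function.comp_apply, rest, hsort, dite_eq_ite]

variable [IsProbabilityMeasure P]

lemma measure_not_abs_dotProduct_mulVec_le (hW : IsSubgaussianNoise P ν W) (x y : Fin n → ℝ)
    {s : ℝ} (hs : 0 ≤ s) :
    P {ω | ¬ |x ⬝ᵥ W ω *ᵥ y| ≤ √(4 * ν * s) * (‖x‖₂ * ‖y‖₂)} ≤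
      ENNReal.ofReal (2 * Real.exp (-s)) := by
  have hsum : ∀ ω, ∑ i, ∑ j, Matrix.vecMulVec x y i j * W ω i j = x ⬝ᵥ W ω *ᵥ y := fun ω => by
    simp only [dotProduct, Matrix.mulVec, Finset.mul_sum, Matrix.vecMulVec_apply]
    exact Finset.sum_congr rfl fun i _ => Finset.sum_congr rfl fun j _ => by ring
  have hproxy : √(2 * ↑(2 * ν * ∑ i, ∑ j, (‖Matrix.vecMulVec x y i j‖₊) ^ 2) * s) =
      √(4 * ν * s) * (‖x‖₂ * ‖y‖₂) := by
    rw [← Real.sqrt_sq (by positivity : 0 ≤ ‖x‖₂ * ‖y‖₂), ← Real.sqrt_mul (by positivity)]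
    congr 1
    push_cast
    simp only [Matrix.vecMulVec_apply, norm_mul, mul_pow, EuclideanSpace.norm_sq_eq,
      Finset.sum_mul_sum]
    ring
  have h := measure_not_abs_le_of_hasSubgaussianMGF
    (hW.hasSubgaussianMGF_sum (Matrix.vecMulVec x y)) hs
  simpa only [hproxy, hsum] using h

lemma measure_not_abs_mulVec_apply_le (hW : IsSubgaussianNoise P ν W) (y : Fin n → ℝ) (j : Fin n)
    {s : ℝ} (hs : 0 ≤ s) :
    P {ω | ¬ |(W ω *ᵥ y) j| ≤ √(4 * ν * s) * ‖y‖₂} ≤ ENNReal.ofReal (2 * Real.exp (-s)) := by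
  simpa [l2_norm_single] using hW.measure_not_abs_dotProduct_mulVec_le (Pi.single j 1) y hs

lemma measure_not_l2_opNorm_le (hW : IsSubgaussianNoise P ν W) {s : ℝ} (hs : 0 ≤ s) :
    P {ω | ¬ ‖W ω‖ ≤ 4 * √(4 * ν * s)} ≤ ENNReal.ofReal (25 ^ n * (2 * Real.exp (-s))) := by
  obtain ⟨t, hcard, ht, hnet⟩ := exists_half_net_card_le (EuclideanSpace ℝ (Fin n))
  rw [finrank_euclideanSpace_fin] at hcard
  have hbound : P {ω | ¬ ∀ p ∈ t ×ˢ t, |p.1.ofLp ⬝ᵥ W ω *ᵥ p.2.ofLp| ≤ √(4 * ν * s)} ≤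
      ENNReal.ofReal ((t ×ˢ t).card * (2 * Real.exp (-s))) := by
    refine measure_not_forall_mem_le _ fun p hp => ?_
    obtain ⟨hp₁, hp₂⟩ := Finset.mem_product.1 hp
    refine (measure_mono fun ω => mt fun h => h.trans ?_).trans
      (hW.measure_not_abs_dotProduct_mulVec_le p.1.ofLp p.2.ofLp hs)
    exact mul_le_of_le_one_right (Real.sqrt_nonneg _)
      (mul_le_one₀ (ht _ hp₁) (norm_nonneg _) (ht _ hp₂))
  refine (measure_mono fun ω => mt fun h => ?_).trans (hbound.trans ?_)
  · exact l2_opNorm_le_of_half_net (Real.sqrt_nonneg _) hnet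
      fun x hx y hy => h (x, y) (Finset.mk_mem_product hx hy)
  · have hcard' : ((t ×ˢ t).card : ℝ) ≤ 25 ^ n := by
      rw [Finset.card_product]
      exact_mod_cast (Nat.mul_le_mul hcard hcard).trans_eq (by rw [← mul_pow]; norm_num)
    gcongr

lemma measure_not_abs_mulVec_leaveOutIterate_le (hW : IsSubgaussianNoise P ν W) (v : Fin n → ℝ)
    (j : Fin n) (k : ℕ) {s : ℝ} (hs : 0 ≤ s) :
    P {ω | ¬ |(W ω *ᵥ leaveOutIterate (W ω) v j k) j| ≤
      √(4 * ν * s) * ‖leaveOutIterate (W ω) v j k‖₂} ≤ ENNReal.ofReal (2 * Real.exp (-s)) := by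
  let b : (Fin n → Fin n → ℝ) → Fin n → ℝ := fun A => Matrix.of A ^ k *ᵥ Function.update v j 0
  have hb : Continuous b := ((continuous_id (X := Matrix (Fin n) (Fin n) ℝ)).pow k).matrix_mulVec
    continuous_const
  have hclosed : IsClosed {q : (Fin n → ℝ) × (Fin n → Fin n → ℝ) |
      |q.1 ⬝ᵥ b q.2| ≤ √(4 * ν * s) * ‖b q.2‖₂} := by
    have hb' := hb.comp (continuous_snd (X := Fin n → ℝ))
    exact isClosed_le (continuous_fst.dotProduct hb').abs
      (continuous_const.mul ((PiLp.continuous_toLp 2 _).comp hb').norm)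
  refine measure_le_of_indepFun (s := {q | |q.1 ⬝ᵥ b q.2| ≤ √(4 * ν * s) * ‖b q.2‖₂}ᶜ)
    (measurable_pi_lambda _ fun k => hW.measurable j k) ?_ (hW.indepFun_row_leaveOut j)
    hclosed.measurableSet.compl fun A => hW.measure_not_abs_mulVec_apply_le (b A) j hs
  refine measurable_pi_lambda _ fun i => measurable_pi_lambda _ fun l => ?_
  simp only [leaveOut, Matrix.of_apply]
  split_ifs
  exacts [measurable_const, hW.measurable i l]

end IsSubgaussianNoise

end Noise

section Levels

variable {n : ℕ}

lemma one_le_log_of_one_le_log_log (h : 1 ≤ Real.log (Real.log n)) : 1 ≤ Real.log n :=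
  h.trans (Real.log_le_self (Real.log_natCast_nonneg n))

lemma natCast_pos_of_one_le_log (h : 1 ≤ Real.log n) : (0 : ℝ) < n := by
  rcases (Nat.cast_nonneg (α := ℝ) n).eq_or_lt with h₀ | h₀
  · rw [← h₀, Real.log_zero] at h
    linarith
  · exact h₀

lemma two_le_of_one_le_log (h : 1 ≤ Real.log n) : (2 : ℝ) ≤ n := by
  have hexp := (Real.le_log_iff_exp_le (natCast_pos_of_one_le_log h)).1 h
  linarith [Real.add_one_le_exp 1]

lemma exists_finset_levels_subset (h : 1 ≤ Real.log (Real.log n)) :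
    ∃ T : Finset ℝ, levels n ⊆ T ∧ (T.card : ℝ) ≤ 2 * n := by
  have hn : 2 ≤ n := by exact_mod_cast two_le_of_one_le_log (one_le_log_of_one_le_log_log h)
  let last := Real.log n ^ (-levelExponent n / 2)
  let S := (Finset.range ⌈levelExponent n⌉₊).image fun k : ℕ => Real.log n ^ (-(k : ℝ) / 2)
  refine ⟨insert last S, ?_, ?_⟩
  · rintro a (⟨k, -, hk, rfl⟩ | rfl)
    · exact Finset.mem_insert_of_mem (Finset.mem_image_of_mem _ (Finset.mem_range.2 hk))
    · exact Finset.mem_insert_self _ _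
  · have hlog : Real.log (2 * n) ≤ (2 * n - 1 : ℕ) := by
      rw [Nat.cast_sub (by lia), Nat.cast_mul, Nat.cast_ofNat, Nat.cast_one]
      exact Real.log_le_sub_one_of_pos (by positivity)
    have hceil : ⌈levelExponent n⌉₊ ≤ 2 * n - 1 :=
      Nat.ceil_le.2 ((div_le_self (Real.log_nonneg (by norm_cast; lia)) h).trans hlog)
    have hS : S.card ≤ 2 * n - 1 := Finset.card_image_le.trans (by rwa [Finset.card_range])
    exact_mod_cast (Finset.card_insert_le last S).trans (by lia)

lemma one_div_sqrt_le_of_mem_levels (h : 1 ≤ Real.log (Real.log n)) {a : ℝ} (ha : a ∈ levels n) :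
    1 / √(2 * n) ≤ a := by
  have hl := one_le_log_of_one_le_log_log h
  have hn := natCast_pos_of_one_le_log hl
  have hlast : Real.log n ^ (-levelExponent n / 2) = 1 / √(2 * n) := by
    rw [Real.rpow_def_of_pos (by linarith), Real.sqrt_eq_rpow, Real.rpow_def_of_pos (by positivity),
      one_div, ← Real.exp_neg, levelExponent]
    congr 1
    field_simp
  rcases ha with ⟨k, -, hk, rfl⟩ | rfl
  · rw [← hlast]
    exact Real.rpow_le_rpow_of_exponent_le hl (by linarith [Nat.lt_ceil.1 hk])
  · exact hlast.ge

lemma pos_of_mem_levels (h : 1 ≤ Real.log (Real.log n)) {a : ℝ} (ha : a ∈ levels n) : 0 < a := by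
  have hn := natCast_pos_of_one_le_log (one_le_log_of_one_le_log_log h)
  exact (by positivity : 0 < 1 / √(2 * n : ℝ)).trans_le (one_div_sqrt_le_of_mem_levels h ha)

end Levels

section Control

open scoped Matrix.Norms.L2Operator

variable {n : ℕ}

/-- The vector of signs of the large entries of `v`, with `0` in place of the other entries; the
entries of `Q` and the sums over `Î` in the algorithm are expressed through it. -/
noncomputable def selectedSigns (v : Fin n → ℝ) (a : ℝ) (k : Fin n) : ℝ :=
  if k ∈ largeEntries v a then Real.sign (v k) else 0

lemma l2_norm_selectedSigns_le (v : Fin n → ℝ) (a : ℝ) :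
    ‖selectedSigns v a‖₂ ≤ √((largeEntries v a).card : ℝ) := by
  rw [EuclideanSpace.norm_eq]
  refine Real.sqrt_le_sqrt ?_
  have hle : ∀ k, ‖selectedSigns v a k‖ ^ 2 ≤ if k ∈ largeEntries v a then 1 else 0 := fun k => by
    rw [selectedSigns]
    split_ifs
    · rcases Real.sign_apply_eq (v k) with h | h | h <;> simp [h]
    · simp
  simpa using Finset.sum_le_sum fun k (_ : k ∈ Finset.univ) => hle k

/-- The event on which the algorithm is shown to succeed: the noise `W` is bounded in operator norm,
its rows are bounded against the leave-one-out iterates of `v`, and its sums over the level sets of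
`v` are bounded. The scale `κ` stands for `√(ν log n)`. -/
structure IsControlled (W : Matrix (Fin n) (Fin n) ℝ) (v : Fin n → ℝ) (κ : ℝ) : Prop where
  opNorm : ‖W‖ ≤ 28 * κ * √n
  leaveOut : ∀ j, ∀ k < ⌈Real.log n⌉₊,
    |(W *ᵥ leaveOutIterate W v j k) j| ≤ 7 * κ * ‖leaveOutIterate W v j k‖₂
  row : ∀ a ∈ levels n, ∀ j, |(W *ᵥ selectedSigns v a) j| ≤ 7 * κ * √(largeEntries v a).card
  quad : ∀ a ∈ levels n,
    |selectedSigns v a ⬝ᵥ W *ᵥ selectedSigns v a| ≤ 7 * κ * (largeEntries v a).card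

lemma IsControlled.abs_smul_mulVec_leaveOutIterate_le {W : Matrix (Fin n) (Fin n) ℝ}
    {v : Fin n → ℝ} {κ : ℝ} (h : IsControlled W v κ) (c : ℝ) (j : Fin n) {k : ℕ}
    (hk : k < ⌈Real.log n⌉₊) :
    |((c • W) *ᵥ leaveOutIterate (c • W) v j k) j| ≤
      |c| * (7 * κ) * ‖leaveOutIterate (c • W) v j k‖₂ := by
  rw [leaveOutIterate_smul, Matrix.smul_mulVec, Matrix.mulVec_smul, Pi.smul_apply, Pi.smul_apply,
    smul_eq_mul, smul_eq_mul, abs_mul, abs_mul, WithLp.toLp_smul, norm_smul, Real.norm_eq_abs]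
  calc |c| * (|c ^ k| * |(W *ᵥ leaveOutIterate W v j k) j|)
      ≤ |c| * (|c ^ k| * (7 * κ * ‖leaveOutIterate W v j k‖₂)) := by gcongr; exact h.leaveOut j k hk
    _ = |c| * (7 * κ) * (|c ^ k| * ‖leaveOutIterate W v j k‖₂) := by ring

lemma IsControlled.neg {W : Matrix (Fin n) (Fin n) ℝ} {v : Fin n → ℝ} {κ : ℝ}
    (h : IsControlled W v κ) : IsControlled (-W) v κ where
  opNorm := by rw [norm_neg]; exact h.opNorm
  leaveOut j k hk := by simpa using h.abs_smul_mulVec_leaveOutIterate_le (-1) j hk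
  row a ha j := by rw [Matrix.neg_mulVec, Pi.neg_apply, abs_neg]; exact h.row a ha j
  quad a ha := by rw [Matrix.neg_mulVec, dotProduct_neg, abs_neg]; exact h.quad a ha

lemma exp_neg_ofNat_mul_log (k : ℕ) [k.AtLeastTwo] {x : ℝ} (hx : 0 < x) :
    Real.exp (-(OfNat.ofNat k * Real.log x)) = (x ^ (OfNat.ofNat k : ℕ))⁻¹ := by
  rw [Real.exp_neg, ← Nat.cast_ofNat, ← Real.log_pow, Real.exp_log (by positivity)]

lemma sqrt_four_mul_ten_mul_le (ν : ℝ≥0) (l : ℝ) : √(4 * ν * (10 * l)) ≤ 7 * √(ν * l) := by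
  rw [show 4 * (ν : ℝ) * (10 * l) = 40 * (ν * l) by ring, Real.sqrt_mul (by norm_num)]
  gcongr
  exact (Real.sqrt_le_left (by norm_num)).2 (by norm_num)

namespace IsSubgaussianNoise

variable {Ω : Type*} [MeasurableSpace Ω] {P : Measure Ω} [IsProbabilityMeasure P] {ν : ℝ≥0}
  {W : Ω → Matrix (Fin n) (Fin n) ℝ}

lemma measure_not_l2_opNorm_le_log (hW : IsSubgaussianNoise P ν W) (hl : 1 ≤ Real.log n) :
    P {ω | ¬ ‖W ω‖ ≤ 28 * √(ν * Real.log n) * √n} ≤ ENNReal.ofReal (2 * ((n : ℝ) ^ 8)⁻¹) := by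
  have hn : (1 : ℝ) ≤ n := by linarith [two_le_of_one_le_log hl]
  have hscale : 4 * √(4 * ν * (12 * n * Real.log n)) ≤ 28 * √(ν * Real.log n) * √n := by
    rw [show 4 * (ν : ℝ) * (12 * n * Real.log n) = 48 * (ν * Real.log n * n) by ring,
      Real.sqrt_mul (by norm_num), Real.sqrt_mul (by positivity)]
    have h : √48 ≤ 7 := (Real.sqrt_le_left (by norm_num)).2 (by norm_num)
    nlinarith [mul_nonneg (Real.sqrt_nonneg (ν * Real.log n)) (Real.sqrt_nonneg n)]
  have hnet : (25 : ℝ) ^ n ≤ Real.exp (4 * n * Real.log n) := by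
    have h25 : (25 : ℝ) ≤ Real.exp 1 ^ 4 := by
      have := Real.exp_one_gt_d9
      calc (25 : ℝ) ≤ 2.7 ^ 4 := by norm_num
        _ ≤ Real.exp 1 ^ 4 := by gcongr; linarith
    calc (25 : ℝ) ^ n ≤ (Real.exp 1 ^ 4) ^ n := by gcongr
      _ = Real.exp (4 * n * 1) := by rw [← pow_mul, ← Real.exp_nat_mul]; push_cast; ring_nf
      _ ≤ Real.exp (4 * n * Real.log n) := by gcongr
  refine (measure_mono fun ω => mt fun h => h.trans hscale).trans
    ((hW.measure_not_l2_opNorm_le (by positivity)).trans (ENNReal.ofReal_le_ofReal ?_))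
  calc (25 : ℝ) ^ n * (2 * Real.exp (-(12 * n * Real.log n)))
      ≤ Real.exp (4 * n * Real.log n) * (2 * Real.exp (-(12 * n * Real.log n))) := by gcongr
    _ = 2 * Real.exp (-(8 * Real.log n) * n) := by
        rw [mul_left_comm, ← Real.exp_add]; ring_nf
    _ ≤ 2 * Real.exp (-(8 * Real.log n)) := by gcongr; nlinarith
    _ = 2 * ((n : ℝ) ^ 8)⁻¹ := by rw [exp_neg_ofNat_mul_log 8 (by linarith)]

lemma measure_not_abs_leaveOutIterate_le (hW : IsSubgaussianNoise P ν W) (hl : 1 ≤ Real.log n)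
    (v : Fin n → ℝ) :
    P {ω | ¬ ∀ j, ∀ k < ⌈Real.log n⌉₊, |(W ω *ᵥ leaveOutIterate (W ω) v j k) j| ≤
      7 * √(ν * Real.log n) * ‖leaveOutIterate (W ω) v j k‖₂} ≤
      ENNReal.ofReal (2 * ((n : ℝ) ^ 8)⁻¹) := by
  have hn := natCast_pos_of_one_le_log hl
  have hceil : (⌈Real.log n⌉₊ : ℝ) ≤ n := by
    exact_mod_cast Nat.ceil_le.2 (Real.log_le_self hn.le)
  have hunion := measure_not_forall_mem_le (P := P)
    (Finset.univ ×ˢ Finset.range ⌈Real.log n⌉₊) fun q _ =>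
      hW.measure_not_abs_mulVec_leaveOutIterate_le v q.1 q.2 (s := 10 * Real.log n) (by positivity)
  refine (measure_mono fun ω => mt fun h j k hk => ?_).trans
    (hunion.trans (ENNReal.ofReal_le_ofReal ?_))
  · refine (h (j, k) (by simpa using hk)).trans ?_
    gcongr
    exact sqrt_four_mul_ten_mul_le ν _
  · rw [exp_neg_ofNat_mul_log 10 hn, Finset.card_product, Finset.card_univ, Fintype.card_fin,
      Finset.card_range, Nat.cast_mul]
    calc (n : ℝ) * ⌈Real.log n⌉₊ * (2 * ((n : ℝ) ^ 10)⁻¹) ≤ n * n * (2 * ((n : ℝ) ^ 10)⁻¹) := by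
          gcongr
      _ = 2 * ((n : ℝ) ^ 8)⁻¹ := by field_simp

lemma measure_not_abs_mulVec_selectedSigns_le (hW : IsSubgaussianNoise P ν W)
    (hn : 1 ≤ Real.log (Real.log n)) (v : Fin n → ℝ) :
    P {ω | ¬ ∀ a ∈ levels n, ∀ j, |(W ω *ᵥ selectedSigns v a) j| ≤
      7 * √(ν * Real.log n) * √(largeEntries v a).card} ≤
      ENNReal.ofReal (4 * ((n : ℝ) ^ 8)⁻¹) := by
  have hl := one_le_log_of_one_le_log_log hn
  have hn₀ := natCast_pos_of_one_le_log hl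
  obtain ⟨T, hT, hcard⟩ := exists_finset_levels_subset hn
  have hunion := measure_not_forall_mem_le (P := P) (T ×ˢ Finset.univ) fun q _ =>
    hW.measure_not_abs_mulVec_apply_le (selectedSigns v q.1) q.2 (s := 10 * Real.log n)
      (by positivity)
  refine (measure_mono fun ω => mt fun h a ha j => ?_).trans
    (hunion.trans (ENNReal.ofReal_le_ofReal ?_))
  · refine (h (a, j) (Finset.mk_mem_product (hT ha) (Finset.mem_univ j))).trans ?_
    exact mul_le_mul (sqrt_four_mul_ten_mul_le ν _) (l2_norm_selectedSigns_le v a)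
      (norm_nonneg _) (by positivity)
  · rw [exp_neg_ofNat_mul_log 10 hn₀, Finset.card_product, Finset.card_univ, Fintype.card_fin,
      Nat.cast_mul]
    calc (T.card : ℝ) * n * (2 * ((n : ℝ) ^ 10)⁻¹) ≤ 2 * n * n * (2 * ((n : ℝ) ^ 10)⁻¹) := by
          gcongr
      _ = 4 * ((n : ℝ) ^ 8)⁻¹ := by field_simp; norm_num

lemma measure_not_abs_selectedSigns_dotProduct_mulVec_le (hW : IsSubgaussianNoise P ν W)
    (hn : 1 ≤ Real.log (Real.log n)) (v : Fin n → ℝ) :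
    P {ω | ¬ ∀ a ∈ levels n, |selectedSigns v a ⬝ᵥ W ω *ᵥ selectedSigns v a| ≤
      7 * √(ν * Real.log n) * (largeEntries v a).card} ≤
      ENNReal.ofReal (4 * ((n : ℝ) ^ 8)⁻¹) := by
  have hl := one_le_log_of_one_le_log_log hn
  have hn₁ : (1 : ℝ) ≤ n := by linarith [two_le_of_one_le_log hl]
  obtain ⟨T, hT, hcard⟩ := exists_finset_levels_subset hn
  have hunion := measure_not_forall_mem_le (P := P) T fun a _ =>
    hW.measure_not_abs_dotProduct_mulVec_le (selectedSigns v a) (selectedSigns v a)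
      (s := 10 * Real.log n) (by positivity)
  refine (measure_mono fun ω => mt fun h a ha => ?_).trans
    (hunion.trans (ENNReal.ofReal_le_ofReal ?_))
  · have hnorm := l2_norm_selectedSigns_le v a
    refine (h a (hT ha)).trans (mul_le_mul (sqrt_four_mul_ten_mul_le ν _) ?_ (by positivity)
      (by positivity))
    exact (mul_self_le_mul_self (norm_nonneg _) hnorm).trans_eq
      (Real.mul_self_sqrt (Nat.cast_nonneg _))
  · rw [exp_neg_ofNat_mul_log 10 (by linarith)]
    calc (T.card : ℝ) * (2 * ((n : ℝ) ^ 10)⁻¹) ≤ 2 * n * n * (2 * ((n : ℝ) ^ 10)⁻¹) := by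
          gcongr
          nlinarith
      _ = 4 * ((n : ℝ) ^ 8)⁻¹ := by field_simp; norm_num

lemma measure_not_isControlled_le (hW : IsSubgaussianNoise P ν W)
    (hn : 1 ≤ Real.log (Real.log n)) (v : Fin n → ℝ) :
    P {ω | ¬ IsControlled (W ω) v √(ν * Real.log n)} ≤ ENNReal.ofReal (12 * ((n : ℝ) ^ 8)⁻¹) := by
  have hl := one_le_log_of_one_le_log_log hn
  have hopNorm := hW.measure_not_l2_opNorm_le_log hl
  have hleaveOut := hW.measure_not_abs_leaveOutIterate_le hl v
  have hrow := hW.measure_not_abs_mulVec_selectedSigns_le hn v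
  have hquad := hW.measure_not_abs_selectedSigns_dotProduct_mulVec_le hn v
  refine (measure_mono fun ω => mt fun h => ⟨h.1, h.2.1, h.2.2.1, h.2.2.2⟩).trans
    ((measure_not_and_le.trans (add_le_add hopNorm (measure_not_and_le.trans
      (add_le_add hleaveOut (measure_not_and_le.trans (add_le_add hrow hquad)))))).trans_eq ?_)
  rw [← ENNReal.ofReal_add (by positivity) (by positivity),
    ← ENNReal.ofReal_add (by positivity) (by positivity),
    ← ENNReal.ofReal_add (by positivity) (by positivity)]
  ring_nf

end IsSubgaussianNoise

end Control

section Perturbation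

lemma abs_abs_sub_abs_le {s x y : ℝ} (hs : s = 1 ∨ s = -1) : |(|x| - |y|)| ≤ |x - s * y| := by
  have h : |s * y| = |y| := by rcases hs with rfl | rfl <;> simp
  exact h ▸ abs_abs_sub_abs_le_abs_sub x (s * y)

lemma sign_eq_of_abs_sub_lt {s x y : ℝ} (hs : s = 1 ∨ s = -1) (h : |x - s * y| < |y|) :
    Real.sign x = s * Real.sign y := by
  obtain ⟨hlo, hhi⟩ := abs_lt.1 h
  rcases lt_trichotomy y 0 with hy | rfl | hy
  · rw [abs_of_neg hy] at hlo hhi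
    rcases hs with rfl | rfl
    · rw [Real.sign_of_neg hy, Real.sign_of_neg (by linarith), one_mul]
    · rw [Real.sign_of_neg hy, Real.sign_of_pos (by linarith), neg_mul_neg, one_mul]
  · exact absurd h (by simp)
  · rw [abs_of_pos hy] at hlo hhi
    rcases hs with rfl | rfl
    · rw [Real.sign_of_pos hy, Real.sign_of_pos (by linarith), one_mul]
    · rw [Real.sign_of_pos hy, Real.sign_of_neg (by linarith), mul_one]

variable {n : ℕ} {u v : Fin n → ℝ} {s ε a : ℝ}

lemma mem_largeEntries {i : Fin n} : i ∈ largeEntries v a ↔ a ≤ |v i| := by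
  simp [largeEntries]

lemma notMem_Ioo_of_notMem_Icc (hs : s = 1 ∨ s = -1) (hε : 0 < ε) (hε₁ : ε ≤ 1) (ha : 0 < a)
    {i : Fin n} (hclose : |u i - s * v i| ≤ ε / 10 * (|v i| + a))
    (hgap : |v i| ∉ Set.Icc ((1 - ε) * a) ((1 + ε) * a)) :
    |u i| ∉ Set.Ioo ((1 - ε / 2) * a) ((1 + ε / 2) * a) := by
  have hεa := mul_pos hε ha
  obtain ⟨hlo, hhi⟩ := abs_le.1 ((abs_abs_sub_abs_le hs).trans hclose)
  rw [Set.mem_Icc, not_and_or, not_le, not_le] at hgap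
  rintro ⟨hu₁, hu₂⟩
  rcases hgap with h | h <;> nlinarith

lemma largeEntries_eq_of_forall_notMem_Ioo (hs : s = 1 ∨ s = -1) (hε : 0 < ε) (hε₁ : ε ≤ 1)
    (ha : 0 < a) (hclose : ∀ i, |u i - s * v i| ≤ ε / 10 * (|v i| + a))
    (hgap : ∀ i, |u i| ∉ Set.Ioo ((1 - ε / 2) * a) ((1 + ε / 2) * a)) :
    largeEntries u a = largeEntries v a := by
  have hεa := mul_pos hε ha
  ext i
  obtain ⟨hlo, hhi⟩ := abs_le.1 ((abs_abs_sub_abs_le hs).trans (hclose i))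
  have hi := hgap i
  rw [Set.mem_Ioo, not_and_or, not_lt, not_lt] at hi
  rw [mem_largeEntries, mem_largeEntries]
  rcases hi with h | h <;> constructor <;> intro hle <;> nlinarith

lemma selectedSigns_eq_smul (hs : s = 1 ∨ s = -1) (hε₁ : ε ≤ 1) (ha : 0 < a)
    (hclose : ∀ i, |u i - s * v i| ≤ ε / 10 * (|v i| + a))
    (hlarge : largeEntries u a = largeEntries v a) :
    selectedSigns u a = s • selectedSigns v a := by
  ext i
  rw [Pi.smul_apply, selectedSigns, selectedSigns, hlarge, smul_eq_mul]
  split_ifs with hi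
  · have hv := mem_largeEntries.1 hi
    exact sign_eq_of_abs_sub_lt hs ((hclose i).trans_lt (by nlinarith))
  · rw [mul_zero]

lemma dInf_le_of_sign {x y : Fin n → ℝ} {r : ℝ} (hs : s = 1 ∨ s = -1) (hr : 0 ≤ r)
    (h : ∀ j, |x j - s * y j| ≤ r) : dInf x y ≤ r := by
  rcases hs with rfl | rfl
  · refine min_le_of_left_le ((pi_norm_le_iff_of_nonneg hr).2 fun j => ?_)
    simpa [Real.norm_eq_abs, abs_sub_comm] using h j
  · refine min_le_of_right_le ((pi_norm_le_iff_of_nonneg hr).2 fun j => ?_)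
    simpa [Real.norm_eq_abs, add_comm] using h j

end Perturbation

section Refinement

variable {n : ℕ} {u v : Fin n → ℝ} {a : ℝ}

lemma signs_mul_self (u : Fin n → ℝ) (ha : 0 < a) (j : Fin n) : signs u a j * signs u a j = 1 := by
  rw [signs]
  split_ifs with hj
  · have hu : u j ≠ 0 := abs_pos.1 (ha.trans_le (mem_largeEntries.1 hj))
    rcases Real.sign_apply_eq_of_ne_zero _ hu with h | h <;> rw [h] <;> norm_num
  · exact one_mul 1

lemma sum_mul_signs (x u : Fin n → ℝ) (a : ℝ) :
    ∑ k ∈ largeEntries u a, x k * signs u a k = x ⬝ᵥ selectedSigns u a := by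
  refine (Finset.sum_congr rfl fun k hk => ?_).trans
    (Finset.sum_subset (Finset.subset_univ _) fun k _ hk => ?_)
  · rw [signs, selectedSigns, if_pos hk, if_pos hk]
  · rw [selectedSigns, if_neg hk, mul_zero]

lemma sum_conjugated (Y : Matrix (Fin n) (Fin n) ℝ) (lh : ℝ) (u : Fin n → ℝ) (a : ℝ)
    (j : Fin n) : ∑ k ∈ largeEntries u a, conjugated Y lh u a j k =
      signs u a j * (orient Y lh *ᵥ selectedSigns u a) j := by
  simp only [conjugated, Matrix.mul_diagonal, Matrix.diagonal_mul]
  simp only [mul_assoc, ← Finset.mul_sum, sum_mul_signs]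
  rfl

lemma selectedSum_eq_dotProduct (Y : Matrix (Fin n) (Fin n) ℝ) (lh : ℝ) (u : Fin n → ℝ) (a : ℝ) :
    selectedSum Y lh u a = selectedSigns u a ⬝ᵥ orient Y lh *ᵥ selectedSigns u a := by
  simp only [selectedSum, sum_conjugated, mul_comm (signs u a _), sum_mul_signs]
  exact dotProduct_comm _ _

lemma signs_mul_refined (Y : Matrix (Fin n) (Fin n) ℝ) (lh : ℝ) (u : Fin n → ℝ) (ha : 0 < a)
    (j : Fin n) : signs u a j * refined Y lh u a j =
      (orient Y lh *ᵥ selectedSigns u a) j /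
        (√(selectedSigns u a ⬝ᵥ orient Y lh *ᵥ selectedSigns u a) * √|lh|) := by
  rw [refined, sum_conjugated, selectedSum_eq_dotProduct, ← mul_div_assoc, ← mul_assoc,
    signs_mul_self u ha, one_mul]

lemma card_largeEntries_mul_le (v : Fin n → ℝ) (a : ℝ) :
    (largeEntries v a).card * a ≤ v ⬝ᵥ selectedSigns v a := by
  rw [← sum_mul_signs, ← nsmul_eq_mul]
  refine Finset.card_nsmul_le_sum _ _ _ fun k hk => (mem_largeEntries.1 hk).trans_eq ?_
  rw [signs, if_pos hk]
  rcases lt_trichotomy (v k) 0 with h | h | h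
  · rw [Real.sign_of_neg h, abs_of_neg h, mul_neg_one]
  · rw [h, abs_zero, zero_mul]
  · rw [Real.sign_of_pos h, abs_of_pos h, mul_one]

lemma dotProduct_selectedSigns_pos {l : ℝ} (ha : 0 < a) (hl : 0 < l)
    (hcard : 1 / (a ^ 2 * l ^ 2) ≤ (largeEntries v a).card) : 0 < v ⬝ᵥ selectedSigns v a := by
  have hpos : (0 : ℝ) < (largeEntries v a).card := lt_of_lt_of_le (by positivity) hcard
  exact (mul_pos hpos ha).trans_le (card_largeEntries_mul_le v a)

lemma card_largeEntries_le_sq {l : ℝ} (ha : 0 < a) (hl : 0 < l)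
    (hcard : 1 / (a ^ 2 * l ^ 2) ≤ (largeEntries v a).card) :
    ((largeEntries v a).card : ℝ) ≤ (l * (v ⬝ᵥ selectedSigns v a)) ^ 2 := by
  rw [div_le_iff₀ (by positivity)] at hcard
  calc ((largeEntries v a).card : ℝ)
      ≤ (largeEntries v a).card * ((largeEntries v a).card * (a ^ 2 * l ^ 2)) :=
        le_mul_of_one_le_right (Nat.cast_nonneg _) hcard
    _ = (l * ((largeEntries v a).card * a)) ^ 2 := by ring
    _ ≤ (l * (v ⬝ᵥ selectedSigns v a)) ^ 2 := by
        gcongr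
        exact card_largeEntries_mul_le v a

lemma abs_div_sqrt_sub_le {x y z t : ℝ} (hx : |x| ≤ 1 / 2) (hy : |y| ≤ 1 / 2) (ht : |t| ≤ 1) :
    |(t + z) / √((1 + x) * (1 + y)) - t| ≤ 3 * (|x| + |y|) + 2 * |z| := by
  have hx' := abs_le.1 hx
  have hy' := abs_le.1 hy
  set D := √((1 + x) * (1 + y))
  have hD_sq : D ^ 2 = (1 + x) * (1 + y) := Real.sq_sqrt (by nlinarith)
  have hD_half : 1 / 2 ≤ D := Real.le_sqrt_of_sq_le (by nlinarith)
  have hD_pos : 0 < D := by linarith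
  have hsq : |1 - D ^ 2| ≤ 5 / 4 * (|x| + |y|) := by
    rw [hD_sq, show 1 - (1 + x) * (1 + y) = -(x + y + x * y) by ring, abs_neg]
    have h := (abs_add_le (x + y) (x * y)).trans (add_le_add_left (abs_add_le x y) _)
    rw [abs_mul] at h
    nlinarith [abs_nonneg x, abs_nonneg y]
  have hsub : |1 - D| ≤ 3 * (|x| + |y|) * D := by
    have h : |1 - D| * (1 + D) = |1 - D ^ 2| := by
      rw [show 1 - D ^ 2 = (1 - D) * (1 + D) by ring, abs_mul,
        abs_of_pos (by linarith : 0 < 1 + D)]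
    nlinarith [abs_nonneg x, abs_nonneg y, abs_nonneg (1 - D)]
  rw [div_sub' hD_pos.ne', abs_div, abs_of_pos hD_pos, div_le_iff₀ hD_pos]
  calc |t + z - D * t| = |t * (1 - D) + z| := by ring_nf
    _ ≤ |t| * |1 - D| + |z| := (abs_add_le _ _).trans_eq (by rw [abs_mul])
    _ ≤ 1 * (3 * (|x| + |y|) * D) + 2 * |z| * D := by gcongr; nlinarith [abs_nonneg z]
    _ = (3 * (|x| + |y|) + 2 * |z|) * D := by ring

lemma half_le_of_abs_sub_div_le {lam lh : ℝ} (hlam : 0 < lam) (hlh : |lh - lam| / lam ≤ 1 / 2) :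
    lam / 2 ≤ lh := by
  rw [div_le_iff₀ hlam] at hlh
  linarith [(abs_le.1 hlh).1]

lemma abs_div_sqrt_mul_sqrt_sub_le {lam lh A Q w t : ℝ} (hlam : 0 < lam) (hA : 0 < A)
    (hQ : |Q| / (lam * A ^ 2) ≤ 1 / 2) (hlh : |lh - lam| / lam ≤ 1 / 2) (ht : |t| ≤ 1) :
    |(lam * t * A + w) / (√(lam * A ^ 2 + Q) * √lh) - t| ≤
      3 * (|Q| / (lam * A ^ 2) + |lh - lam| / lam) + 2 * (|w| / (lam * A)) := by
  have hS : 0 < lam * A ^ 2 := by positivity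
  have h := abs_div_sqrt_sub_le (x := Q / (lam * A ^ 2)) (y := (lh - lam) / lam)
    (z := w / (lam * A)) (by rwa [abs_div, abs_of_pos hS]) (by rwa [abs_div, abs_of_pos hlam]) ht
  rw [abs_div, abs_div, abs_div, abs_of_pos hS, abs_of_pos hlam, abs_of_pos (mul_pos hlam hA)] at h
  have hlh₀ : 0 ≤ lh := (half_pos hlam).le.trans (half_le_of_abs_sub_div_le hlam hlh)
  have hden : √(lam * A ^ 2 + Q) * √lh =
      lam * A * √((1 + Q / (lam * A ^ 2)) * (1 + (lh - lam) / lam)) := by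
    calc √(lam * A ^ 2 + Q) * √lh
        = √((lam * A) ^ 2 * ((1 + Q / (lam * A ^ 2)) * (1 + (lh - lam) / lam))) := by
          rw [← Real.sqrt_mul' _ hlh₀]
          congr 1
          field_simp
          ring
      _ = _ := by rw [Real.sqrt_mul (sq_nonneg _), Real.sqrt_sq (mul_pos hlam hA).le]
  have hnum : lam * t * A + w = lam * A * (t + w / (lam * A)) := by field_simp
  rwa [hden, hnum, mul_div_mul_left _ _ (mul_pos hlam hA).ne']

end Refinement

section Observation

open scoped Matrix.Norms.L2Operator

variable {n : ℕ} {W : Matrix (Fin n) (Fin n) ℝ} {u v : Fin n → ℝ} {lam : ℝ}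

lemma observation_mulVec (lam : ℝ) (v : Fin n → ℝ) (W : Matrix (Fin n) (Fin n) ℝ)
    (x : Fin n → ℝ) : observation lam v W *ᵥ x = (lam * (v ⬝ᵥ x)) • v + W *ᵥ x := by
  rw [observation, Matrix.add_mulVec, Matrix.smul_mulVec, Matrix.vecMulVec_mulVec, op_smul_eq_smul,
    smul_smul]

lemma isHermitian_observation (lam : ℝ) (v : Fin n → ℝ) (hW : W.IsSymm) :
    (observation lam v W).IsHermitian := by
  rw [observation, Matrix.IsHermitian, Matrix.conjTranspose_eq_transpose_of_trivial,
    Matrix.transpose_add, Matrix.transpose_smul, Matrix.transpose_vecMulVec, hW.eq]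

lemma observation_neg (lam : ℝ) (v : Fin n → ℝ) (W : Matrix (Fin n) (Fin n) ℝ) :
    observation (-lam) v (-W) = -observation lam v W := by
  rw [observation, observation, neg_smul, neg_add]

lemma IsTopEigenvector.exists_smul_eq (hW : W.IsSymm) (hv : IsUnitVector v)
    (hu : IsTopEigenvector (observation lam v W) u) :
    ∃ t, lam - ‖W‖ ≤ t ∧ t • u = (lam * (v ⬝ᵥ u)) • v + W *ᵥ u := by
  obtain ⟨-, t, ht, htop⟩ := hu
  refine ⟨t, ?_, ?_⟩
  · have hvv : v ⬝ᵥ v = 1 := by rw [dotProduct_self_eq_l2_norm_sq, hv.l2_norm_eq_one, one_pow]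
    have hrayleigh := dotProduct_mulVec_le_of_forall_hasEigenvalue_le
      (isHermitian_observation lam v hW) htop v
    rw [observation_mulVec, dotProduct_add, dotProduct_smul, hvv, smul_eq_mul] at hrayleigh
    have hquad : |v ⬝ᵥ W *ᵥ v| ≤ ‖W‖ := by
      simpa [hv.l2_norm_eq_one] using (abs_dotProduct_le v (W *ᵥ v)).trans
        (mul_le_mul_of_nonneg_left (l2_norm_mulVec_le le_rfl v) (norm_nonneg _))
    linarith [(abs_le.1 hquad).1]
  · rw [← observation_mulVec, ← Matrix.toLin'_apply]
    exact ht.apply_eq_smul.symm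

lemma pow_ceil_log_le {r x : ℝ} (hx : 0 < x) (hr : 0 ≤ r) (hr₁ : r ≤ Real.exp (-1)) :
    r ^ ⌈Real.log x⌉₊ ≤ x⁻¹ :=
  calc r ^ ⌈Real.log x⌉₊ ≤ Real.exp (-1) ^ ⌈Real.log x⌉₊ := by gcongr
    _ = Real.exp (-⌈Real.log x⌉₊) := by rw [← Real.exp_nat_mul, mul_neg_one]
    _ ≤ Real.exp (-Real.log x) := by gcongr; exact Nat.le_ceil _
    _ = x⁻¹ := by rw [Real.exp_neg, Real.exp_log hx]

lemma pow_ceil_log_succ_le {c x : ℝ} (hx : 1 ≤ x) (hc : 0 ≤ c) (hcx : c * √x ≤ Real.exp (-1)) :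
    (c * √x) ^ (⌈Real.log x⌉₊ + 1) ≤ c :=
  calc (c * √x) ^ (⌈Real.log x⌉₊ + 1) ≤ x⁻¹ * (c * √x) := by
        rw [pow_succ]
        gcongr
        exact pow_ceil_log_le (by linarith) (by positivity) hcx
    _ = c * (√x / x) := by ring
    _ ≤ c := mul_le_of_le_one_right hc
        ((div_le_one (by linarith)).2 (Real.sqrt_le_iff.2 ⟨by linarith, by nlinarith⟩))

lemma IsControlled.exists_sign_abs_apply_sub_le_of_smul_eq {κ q t r : ℝ} (h : IsControlled W v κ)
    (hκ : 0 ≤ κ) (ht : 0 < t) (hrt : 28 * κ * √n ≤ r * t) (hr : r ≤ 1 / 80) (hu : IsUnitVector u)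
    (hv : IsUnitVector v) (heig : t • u = q • v + W *ᵥ u) :
    ∃ s, (s = 1 ∨ s = -1) ∧ ∀ j, |u j - s * v j| ≤
      3 * r * |v j| + 1.1 * (7 * κ / t) + r ^ (⌈Real.log n⌉₊ + 1) := by
  have hr₀ : 0 ≤ r := nonneg_of_mul_nonneg_left (le_trans (by positivity) hrt) ht
  have hnorm : ‖t⁻¹ • W‖ ≤ r := by
    rw [norm_smul, norm_inv, Real.norm_of_nonneg ht.le, inv_mul_le_iff₀ ht, mul_comm]
    exact h.opNorm.trans hrt
  have hfix : u = (t⁻¹ * q) • v + (t⁻¹ • W) *ᵥ u := by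
    rw [Matrix.smul_mulVec, ← smul_smul, ← smul_add, ← heig, inv_smul_smul₀ ht.ne']
  obtain ⟨s, hs, hsj⟩ := exists_sign_abs_apply_sub_le hnorm (by linarith) (by positivity)
    hu.l2_norm_eq_one hv.l2_norm_eq_one hfix fun j k hk =>
      h.abs_smul_mulVec_leaveOutIterate_le t⁻¹ j hk
  refine ⟨s, hs, fun j => (hsj j).trans ?_⟩
  rw [abs_of_pos (inv_pos.2 ht), inv_mul_eq_div]
  gcongr
  · rw [div_le_iff₀ (by linarith)]
    nlinarith
  · rw [div_le_iff₀ (by nlinarith)]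
    nlinarith

lemma IsControlled.exists_sign_abs_apply_sub_le {κ ε : ℝ} (h : IsControlled W v κ)
    (hl : 1 ≤ Real.log n) (hκ : 0 ≤ κ) (hlam : 0 < lam) (hε₁ : ε ≤ 1)
    (hlarge : 2400 * κ * √n ≤ ε * lam) (hW : W.IsSymm) (hv : IsUnitVector v)
    (hu : IsTopEigenvector (observation lam v W) u) :
    ∃ s, (s = 1 ∨ s = -1) ∧ ∀ j, |u j - s * v j| ≤ ε / 10 * |v j| + 40 * (κ / lam) := by
  obtain ⟨t, ht, heig⟩ := hu.exists_smul_eq hW hv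
  have hn := two_le_of_one_le_log hl
  set x := κ / lam
  set r := 28.4 * x * √n with hr
  have hx₀ : 0 ≤ x := by positivity
  have hr₀ : 0 ≤ r := by positivity
  have hκx : κ = x * lam := (div_mul_cancel₀ κ hlam.ne').symm
  have hrε : r ≤ ε / 80 := by
    refine le_of_mul_le_mul_right ?_ hlam
    have hεlam : 0 ≤ ε * lam := le_trans (by positivity) hlarge
    rw [show r * lam = 28.4 * κ * √n by rw [hκx]; ring]
    linarith
  have ht_ge : 0.987 * lam ≤ t := by
    have hop := h.opNorm
    nlinarith
  have hrt : 28 * κ * √n ≤ r * t :=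
    calc 28 * κ * √n ≤ r * (0.987 * lam) := by
          rw [hκx, hr]
          nlinarith [mul_nonneg (mul_nonneg hx₀ hlam.le) (Real.sqrt_nonneg n)]
      _ ≤ r * t := by gcongr
  obtain ⟨s, hs, hsj⟩ := h.exists_sign_abs_apply_sub_le_of_smul_eq hκ (by linarith) hrt
    (by linarith) hu.1 hv heig
  have hscale : 7 * κ / t ≤ 7.1 * x := by
    rw [div_le_iff₀ (by linarith), hκx]
    nlinarith
  have htail : r ^ (⌈Real.log n⌉₊ + 1) ≤ 28.4 * x :=
    pow_ceil_log_succ_le (by linarith) (by positivity) (by linarith [Real.exp_neg_one_gt_d9])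
  refine ⟨s, hs, fun j => (hsj j).trans ?_⟩
  have hsignal : 3 * r * |v j| ≤ ε / 10 * |v j| := by
    gcongr
    linarith
  linarith

end Observation

section Guarantee

variable {n : ℕ} {W : Matrix (Fin n) (Fin n) ℝ} {u v : Fin n → ℝ} {κ lam lh a s : ℝ}

lemma dotProduct_observation_mulVec (lam : ℝ) (v : Fin n → ℝ) (W : Matrix (Fin n) (Fin n) ℝ)
    (g : Fin n → ℝ) :
    g ⬝ᵥ observation lam v W *ᵥ g = lam * (v ⬝ᵥ g) ^ 2 + g ⬝ᵥ W *ᵥ g := by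
  rw [observation_mulVec, dotProduct_add, dotProduct_smul, dotProduct_comm g v, smul_eq_mul]
  ring

lemma orient_of_nonneg (Y : Matrix (Fin n) (Fin n) ℝ) (hlh : 0 ≤ lh) : orient Y lh = Y :=
  if_neg hlh.not_gt

lemma IsControlled.abs_selectedSigns_dotProduct_mulVec_div_le (h : IsControlled W v κ)
    (hl : 0 < Real.log n) (hκ : 0 ≤ κ) (hlam : 0 < lam) (ha : a ∈ levels n) (ha₀ : 0 < a)
    (hcard : 1 / (a ^ 2 * Real.log n ^ 2) ≤ (largeEntries v a).card) :
    |selectedSigns v a ⬝ᵥ W *ᵥ selectedSigns v a| / (lam * (v ⬝ᵥ selectedSigns v a) ^ 2) ≤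
      7 * (κ * Real.log n ^ 2 / lam) := by
  have hA := dotProduct_selectedSigns_pos ha₀ hl hcard
  rw [div_le_iff₀ (by positivity)]
  calc |selectedSigns v a ⬝ᵥ W *ᵥ selectedSigns v a|
      ≤ 7 * κ * (largeEntries v a).card := h.quad a ha
    _ ≤ 7 * κ * (Real.log n * (v ⬝ᵥ selectedSigns v a)) ^ 2 := by
        gcongr
        exact card_largeEntries_le_sq ha₀ hl hcard
    _ = 7 * (κ * Real.log n ^ 2 / lam) * (lam * (v ⬝ᵥ selectedSigns v a) ^ 2) := by field_simp

lemma IsControlled.abs_mulVec_selectedSigns_div_le (h : IsControlled W v κ)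
    (hl : 0 < Real.log n) (hκ : 0 ≤ κ) (hlam : 0 < lam) (ha : a ∈ levels n) (ha₀ : 0 < a)
    (hcard : 1 / (a ^ 2 * Real.log n ^ 2) ≤ (largeEntries v a).card) (j : Fin n) :
    |(W *ᵥ selectedSigns v a) j| / (lam * (v ⬝ᵥ selectedSigns v a)) ≤
      7 * (κ * Real.log n / lam) := by
  have hA := dotProduct_selectedSigns_pos ha₀ hl hcard
  rw [div_le_iff₀ (by positivity)]
  calc |(W *ᵥ selectedSigns v a) j| ≤ 7 * κ * √(largeEntries v a).card := h.row a ha j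
    _ ≤ 7 * κ * (Real.log n * (v ⬝ᵥ selectedSigns v a)) := by
        gcongr
        exact (Real.sqrt_le_left (by positivity)).2 (card_largeEntries_le_sq ha₀ hl hcard)
    _ = 7 * (κ * Real.log n / lam) * (lam * (v ⬝ᵥ selectedSigns v a)) := by field_simp

lemma IsControlled.selectedSum_pos (h : IsControlled W v κ) (hl : 0 < Real.log n) (hκ : 0 ≤ κ)
    (hlam : 0 < lam) (hκlam : 7 * (κ * Real.log n ^ 2 / lam) ≤ 1 / 2) (hlh : 0 ≤ lh)
    (hs : s = 1 ∨ s = -1) (ha : a ∈ levels n) (ha₀ : 0 < a)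
    (hcard : 1 / (a ^ 2 * Real.log n ^ 2) ≤ (largeEntries v a).card)
    (hsigns : selectedSigns u a = s • selectedSigns v a) :
    0 < selectedSum (observation lam v W) lh u a := by
  have hA := dotProduct_selectedSigns_pos ha₀ hl hcard
  have hquad := (h.abs_selectedSigns_dotProduct_mulVec_div_le hl hκ hlam ha ha₀ hcard).trans hκlam
  rw [div_le_iff₀ (by positivity)] at hquad
  have hss : s * s = 1 := mul_self_eq_one_iff.2 hs
  rw [selectedSum_eq_dotProduct, orient_of_nonneg _ hlh, hsigns, Matrix.mulVec_smul,
    smul_dotProduct, dotProduct_smul, smul_smul, hss, one_smul, dotProduct_observation_mulVec]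
  linarith [(abs_le.1 hquad).1, mul_pos hlam (pow_pos hA 2)]

lemma IsControlled.abs_signs_mul_refined_sub_le (h : IsControlled W v κ) (hl : 1 ≤ Real.log n)
    (hκ : 0 ≤ κ) (hlam : 0 < lam) (hκlam : 7 * (κ * Real.log n ^ 2 / lam) ≤ 1 / 2)
    (hlh : |lh - lam| / lam ≤ 1 / 2) (hv : IsUnitVector v) (hs : s = 1 ∨ s = -1)
    (ha : a ∈ levels n) (ha₀ : 0 < a)
    (hcard : 1 / (a ^ 2 * Real.log n ^ 2) ≤ (largeEntries v a).card)
    (hsigns : selectedSigns u a = s • selectedSigns v a) (j : Fin n) :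
    |signs u a j * refined (observation lam v W) lh u a j - s * v j| ≤
      3 * (|lh - lam| / lam) + 35 * (κ * Real.log n ^ 2 / lam) := by
  have hl₀ : 0 < Real.log n := by linarith
  have hquad := h.abs_selectedSigns_dotProduct_mulVec_div_le hl₀ hκ hlam ha ha₀ hcard
  have hrow := h.abs_mulVec_selectedSigns_div_le hl₀ hκ hlam ha ha₀ hcard j
  have hlh₀ : 0 ≤ lh := (half_pos hlam).le.trans (half_le_of_abs_sub_div_le hlam hlh)
  have hvj : |v j| ≤ 1 := hv.l2_norm_eq_one ▸ abs_apply_le_l2_norm v j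
  have hss : s * s = 1 := mul_self_eq_one_iff.2 hs
  have hquotient := abs_div_sqrt_mul_sqrt_sub_le (w := (W *ᵥ selectedSigns v a) j) hlam
    (dotProduct_selectedSigns_pos ha₀ hl₀ hcard) (hquad.trans hκlam) hlh hvj
  have hform : signs u a j * refined (observation lam v W) lh u a j =
      s * ((lam * v j * (v ⬝ᵥ selectedSigns v a) + (W *ᵥ selectedSigns v a) j) /
        (√(lam * (v ⬝ᵥ selectedSigns v a) ^ 2 +
          selectedSigns v a ⬝ᵥ W *ᵥ selectedSigns v a) * √lh)) := by
    rw [signs_mul_refined _ _ _ ha₀, orient_of_nonneg _ hlh₀, abs_of_nonneg hlh₀, hsigns,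
      Matrix.mulVec_smul, smul_dotProduct, dotProduct_smul, smul_smul, hss, one_smul,
      dotProduct_observation_mulVec, observation_mulVec, Pi.smul_apply, smul_eq_mul, mul_div_assoc,
      Pi.add_apply, Pi.smul_apply, smul_eq_mul, mul_right_comm]
  have hlog : κ * Real.log n / lam ≤ κ * Real.log n ^ 2 / lam := by
    gcongr
    exact le_self_pow₀ hl two_ne_zero
  rw [hform, ← mul_sub, abs_mul, (abs_eq zero_le_one).2 hs, one_mul]
  linarith

end Guarantee

section Favorable

variable {n : ℕ} {W : Matrix (Fin n) (Fin n) ℝ} {u v : Fin n → ℝ} {κ lam lh a s ε σ : ℝ}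

lemma forty_mul_div_le_of_mem_levels (hn : 1 ≤ Real.log (Real.log n)) (hlam : 0 < lam)
    (hε : 0 ≤ ε) (hlarge : 2400 * κ * √n ≤ ε * lam) (ha : a ∈ levels n) :
    40 * (κ / lam) ≤ ε / 10 * a := by
  have hn₀ := natCast_pos_of_one_le_log (one_le_log_of_one_le_log_log hn)
  have hsqrt : √(2 * n : ℝ) ≤ 2 * √n := by
    rw [Real.sqrt_mul zero_le_two]
    gcongr
    exact Real.sqrt_le_iff.2 ⟨zero_le_two, by norm_num⟩
  calc 40 * (κ / lam) ≤ ε / 10 * (1 / (2 * √n)) := by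
        rw [← mul_div_assoc, mul_one_div, div_le_div_iff₀ hlam (by positivity)]
        nlinarith [mul_nonneg hε hlam.le]
    _ ≤ ε / 10 * (1 / √(2 * n)) := by gcongr
    _ ≤ ε / 10 * a := by
        gcongr
        exact one_div_sqrt_le_of_mem_levels hn ha

lemma seven_mul_log_sq_div_le (hκ : 0 ≤ κ) (hlam : 0 < lam) (hε₁ : ε ≤ 1)
    (hlarge : 2400 * κ * √n ≤ ε * lam) (hlog : Real.log n ^ 2 ≤ √n) :
    7 * (κ * Real.log n ^ 2 / lam) ≤ 1 / 2 := by
  rw [← mul_div_assoc, div_le_iff₀ hlam]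
  nlinarith [mul_le_mul_of_nonneg_left hlog hκ, mul_le_mul_of_nonneg_right hε₁ hlam.le]

lemma abs_sub_le_of_abs_le {x y p q : ℝ} (hs : s = 1 ∨ s = -1)
    (h : |x - s * y| ≤ |y| / 10 + 40 * q) (hq : q ≤ p) (hx : |x| ≤ 2 * p) :
    |x - s * y| ≤ 45 * p := by
  have hp : 0 ≤ p := by linarith [abs_nonneg x]
  linarith [(abs_le.1 (abs_abs_sub_abs_le hs (x := x) (y := y))).1]

lemma abs_le_of_le_div_mul_log {x : ℝ} (hl : 1 ≤ Real.log n) (hκ : 0 ≤ κ) (hlam : 0 < lam)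
    (hlh : |lh - lam| / lam ≤ 1 / 2) (hσ : σ ≤ κ) (hx : |x| ≤ σ / |lh| * Real.log n) :
    |x| ≤ 2 * (κ * Real.log n ^ 2 / lam) := by
  have hlh_half := (half_le_of_abs_sub_div_le hlam hlh).trans (le_abs_self lh)
  calc |x| ≤ σ / |lh| * Real.log n := hx
    _ ≤ κ / (lam / 2) * Real.log n ^ 2 := by
        gcongr
        exact le_self_pow₀ hl two_ne_zero
    _ = 2 * (κ * Real.log n ^ 2 / lam) := by field_simp

/-- All that the deterministic part of the argument needs: a positive spike of size `lam` which
dominates a controlled noise matrix, and an eigenvalue estimate of the right order. -/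
structure IsFavorable (σ ε κ lam lh : ℝ) (v : Fin n → ℝ) (W : Matrix (Fin n) (Fin n) ℝ) :
    Prop where
  one_le_log_log : 1 ≤ Real.log (Real.log n)
  log_sq_le : Real.log n ^ 2 ≤ √n
  noise_nonneg : 0 ≤ κ
  sigma_le : σ ≤ κ
  spike_pos : 0 < lam
  gap_pos : 0 < ε
  gap_le_one : ε ≤ 1
  noise_le : 2400 * κ * √n ≤ ε * lam
  estimate : |lh - lam| / lam ≤ 1 / 2
  symm : W.IsSymm
  unit : IsUnitVector v
  isControlled : IsControlled W v κ

namespace IsFavorable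

lemma one_le_log (h : IsFavorable σ ε κ lam lh v W) : 1 ≤ Real.log n :=
  one_le_log_of_one_le_log_log h.one_le_log_log

lemma estimate_pos (h : IsFavorable σ ε κ lam lh v W) : 0 < lh :=
  (half_pos h.spike_pos).trans_le (half_le_of_abs_sub_div_le h.spike_pos h.estimate)

lemma log_sq_div_le (h : IsFavorable σ ε κ lam lh v W) :
    7 * (κ * Real.log n ^ 2 / lam) ≤ 1 / 2 :=
  seven_mul_log_sq_div_le h.noise_nonneg h.spike_pos h.gap_le_one h.noise_le h.log_sq_le

lemma exists_sign (h : IsFavorable σ ε κ lam lh v W)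
    (hu : IsTopEigenvector (observation lam v W) u) :
    ∃ s : ℝ, (s = 1 ∨ s = -1) ∧ ∀ j, |u j - s * v j| ≤ ε / 10 * |v j| + 40 * (κ / lam) :=
  h.isControlled.exists_sign_abs_apply_sub_le h.one_le_log h.noise_nonneg h.spike_pos
    h.gap_le_one h.noise_le h.symm h.unit hu

lemma abs_sub_le_of_mem_levels (h : IsFavorable σ ε κ lam lh v W) (ha : a ∈ levels n)
    (hclose : ∀ j, |u j - s * v j| ≤ ε / 10 * |v j| + 40 * (κ / lam)) (j : Fin n) :
    |u j - s * v j| ≤ ε / 10 * (|v j| + a) := by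
  rw [mul_add]
  exact (hclose j).trans (add_le_add_right (forty_mul_div_le_of_mem_levels h.one_le_log_log
    h.spike_pos h.gap_pos.le h.noise_le ha) _)

lemma exists_isAdmissible (h : IsFavorable σ ε κ lam lh v W) (hgap : HasEntryGap ε v)
    (hu : IsTopEigenvector (observation lam v W) u) : ∃ a, IsAdmissible (ε / 2) u a := by
  obtain ⟨s, hs, hclose⟩ := h.exists_sign hu
  obtain ⟨a, ha, -, hcard, hgap⟩ := hgap
  have ha₀ := pos_of_mem_levels h.one_le_log_log ha
  have hclose := h.abs_sub_le_of_mem_levels ha hclose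
  have hgap_u i := notMem_Ioo_of_notMem_Icc hs h.gap_pos h.gap_le_one ha₀ (hclose i) (hgap i)
  have hentries :=
    largeEntries_eq_of_forall_notMem_Ioo hs h.gap_pos h.gap_le_one ha₀ hclose hgap_u
  exact ⟨a, ha, hentries ▸ hcard.le, hgap_u⟩

lemma selectedSigns_eq_smul_and_card (h : IsFavorable σ ε κ lam lh v W) (hs : s = 1 ∨ s = -1)
    (hclose : ∀ j, |u j - s * v j| ≤ ε / 10 * |v j| + 40 * (κ / lam))
    (ha : IsAdmissible (ε / 2) u a) :
    selectedSigns u a = s • selectedSigns v a ∧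
      1 / (a ^ 2 * Real.log n ^ 2) ≤ (largeEntries v a).card := by
  have ha₀ := pos_of_mem_levels h.one_le_log_log ha.mem
  have hclose := h.abs_sub_le_of_mem_levels ha.mem hclose
  have hentries :=
    largeEntries_eq_of_forall_notMem_Ioo hs h.gap_pos h.gap_le_one ha₀ hclose ha.gap
  exact ⟨selectedSigns_eq_smul hs h.gap_le_one ha₀ hclose hentries, hentries ▸ ha.card_ge⟩

lemma selectedSum_pos (h : IsFavorable σ ε κ lam lh v W)
    (hu : IsTopEigenvector (observation lam v W) u) (ha : IsAdmissible (ε / 2) u a) :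
    0 < selectedSum (observation lam v W) lh u a := by
  obtain ⟨s, hs, hclose⟩ := h.exists_sign hu
  obtain ⟨hsigns, hcard⟩ := h.selectedSigns_eq_smul_and_card hs hclose ha
  exact h.isControlled.selectedSum_pos (by linarith [h.one_le_log]) h.noise_nonneg h.spike_pos
    h.log_sq_div_le h.estimate_pos.le hs ha.mem (pos_of_mem_levels h.one_le_log_log ha.mem) hcard
    hsigns

lemma dInf_output_le (h : IsFavorable σ ε κ lam lh v W)
    (hu : IsTopEigenvector (observation lam v W) u) (ha : IsAdmissible (ε / 2) u a) :
    dInf (output σ (observation lam v W) lh u a) v ≤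
      3 * (|lh - lam| / lam) + 45 * (κ * Real.log n ^ 2 / lam) := by
  have hκ := h.noise_nonneg
  have hlam := h.spike_pos
  have hl := h.one_le_log
  have hestimate : 0 ≤ |lh - lam| / lam := by positivity
  have hnoise : 0 ≤ κ * Real.log n ^ 2 / lam := by positivity
  obtain ⟨s, hs, hclose⟩ := h.exists_sign hu
  refine dInf_le_of_sign hs (by positivity) fun j => ?_
  rw [output]
  split_ifs with hj
  · have hclose_j : |u j - s * v j| ≤ |v j| / 10 + 40 * (κ / lam) := by
      linarith [hclose j, mul_le_mul_of_nonneg_right h.gap_le_one (abs_nonneg (v j))]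
    have hlog : κ / lam ≤ κ * Real.log n ^ 2 / lam := by
      gcongr
      exact le_mul_of_one_le_right hκ (one_le_pow₀ hl)
    linarith [abs_sub_le_of_abs_le hs hclose_j hlog
      (abs_le_of_le_div_mul_log hl hκ hlam h.estimate h.sigma_le hj)]
  · obtain ⟨hsigns, hcard⟩ := h.selectedSigns_eq_smul_and_card hs hclose ha
    linarith [h.isControlled.abs_signs_mul_refined_sub_le hl hκ hlam h.log_sq_div_le h.estimate
      h.unit hs ha.mem (pos_of_mem_levels h.one_le_log_log ha.mem) hcard hsigns j]

theorem runsWithin (h : IsFavorable σ ε κ lam lh v W) (hgap : HasEntryGap ε v) :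
    RunsWithin σ (ε / 2) (observation lam v W) lh v
      (3 * (|lh - lam| / lam) + 45 * (κ * Real.log n ^ 2 / lam)) := by
  have hn : 0 < n := by exact_mod_cast natCast_pos_of_one_le_log h.one_le_log
  have horient := orient_of_nonneg (observation lam v W) h.estimate_pos.le
  refine ⟨h.estimate_pos.ne', ?_, ?_, ?_, ?_⟩ <;> rw [horient]
  · exact exists_isTopEigenvector hn (isHermitian_observation lam v h.symm)
  · exact fun u => h.exists_isAdmissible hgap
  · exact fun u a => h.selectedSum_pos
  · exact fun u a => h.dInf_output_le

end IsFavorable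

end Favorable

section RunsWithin

variable {n : ℕ} {v : Fin n → ℝ} {Y : Matrix (Fin n) (Fin n) ℝ} {σ β lh : ℝ}

lemma RunsWithin.mono {r r' : ℝ} (h : RunsWithin σ β Y lh v r) (hr : r ≤ r') :
    RunsWithin σ β Y lh v r' :=
  ⟨h.1, h.2, h.3, h.4, fun u a hu ha => (h.5 u a hu ha).trans hr⟩

lemma orient_neg_neg (Y : Matrix (Fin n) (Fin n) ℝ) (hlh : lh ≠ 0) :
    orient (-Y) (-lh) = orient Y lh := by
  rcases lt_or_gt_of_ne hlh with h | h
  · rw [orient, orient, if_pos h, if_neg (by linarith)]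
  · rw [orient, orient, if_pos (by linarith), if_neg (by linarith), neg_neg]

lemma RunsWithin.of_neg {r : ℝ} (h : RunsWithin σ β (-Y) (-lh) v r) :
    RunsWithin σ β Y lh v r := by
  have hlh : lh ≠ 0 := neg_ne_zero.1 h.estimate_ne_zero
  have hconj u a : conjugated (-Y) (-lh) u a = conjugated Y lh u a := by
    rw [conjugated, conjugated, orient_neg_neg Y hlh]
  have hsum u a : selectedSum (-Y) (-lh) u a = selectedSum Y lh u a := by
    rw [selectedSum, selectedSum, hconj]
  have hout u a : output σ (-Y) (-lh) u a = output σ Y lh u a := by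
    ext j
    rw [output, output, refined, refined, hsum, hconj, abs_neg]
  obtain ⟨-, heigenvector, hthreshold, hpos, hdist⟩ := h
  simp only [orient_neg_neg Y hlh, hsum, hout] at heigenvector hthreshold hpos hdist
  exact ⟨hlh, heigenvector, hthreshold, hpos, hdist⟩

end RunsWithin

section Assembly

variable {n : ℕ} {v : Fin n → ℝ} {C₂ ε lam lh σ : ℝ} {ν : ℝ≥0}

lemma sqrt_mul_rpow_five_halves (ν : ℝ≥0) {l : ℝ} (hl : 0 < l) :
    √(ν : ℝ) * l ^ (5 / 2 : ℝ) = √(ν * l) * l ^ 2 := by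
  rw [Real.sqrt_mul ν.coe_nonneg, show (5 / 2 : ℝ) = 1 / 2 + 2 by norm_num, Real.rpow_add hl,
    ← Real.sqrt_eq_rpow, Real.rpow_two]
  ring

lemma sqrt_le_sqrt_mul_log (ν : ℝ≥0) (hl : 1 ≤ Real.log n) : √(ν : ℝ) ≤ √(ν * Real.log n) :=
  Real.sqrt_le_sqrt (le_mul_of_one_le_right ν.coe_nonneg hl)

lemma noise_le_of_div_mul_sqrt_le (hε : 0 < ε)
    (hlarge : 2400 / ε * √((ν : ℝ) * n * Real.log n) ≤ lam) :
    2400 * √(ν * Real.log n) * √n ≤ ε * lam := by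
  rw [div_mul_eq_mul_div, div_le_iff₀ hε] at hlarge
  calc 2400 * √(ν * Real.log n) * √n = 2400 * √((ν : ℝ) * n * Real.log n) := by
        rw [mul_assoc, ← Real.sqrt_mul' _ n.cast_nonneg]
        ring_nf
    _ ≤ ε * lam := by linarith

lemma runsWithin_of_pos {W : Matrix (Fin n) (Fin n) ℝ} (hn : 1 ≤ Real.log (Real.log n))
    (hlog : (1 + C₂) * Real.log n ^ 2 ≤ √n) (hC₂ : 0 ≤ C₂) (hε : 0 < ε) (hε₁ : ε ≤ 1)
    (hσ : σ ≤ √(ν : ℝ)) (hlam : 0 < lam)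
    (hlarge : 2400 / ε * √((ν : ℝ) * n * Real.log n) ≤ lam) (hW : W.IsSymm)
    (hv : IsUnitVector v) (hgap : HasEntryGap ε v)
    (hcontrol : IsControlled W v √(ν * Real.log n))
    (hlh : |lh - lam| ≤ C₂ * √(ν : ℝ) * Real.log n ^ (5 / 2 : ℝ)) :
    RunsWithin σ (ε / 2) (observation lam v W) lh v
      ((3 * C₂ + 45) * √(ν : ℝ) * Real.log n ^ (5 / 2 : ℝ) / lam) := by
  have hl := one_le_log_of_one_le_log_log hn
  have hnoise := noise_le_of_div_mul_sqrt_le hε hlarge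
  rw [mul_assoc, sqrt_mul_rpow_five_halves ν (by linarith)] at hlh ⊢
  have hκ := Real.sqrt_nonneg ((ν : ℝ) * Real.log n)
  have hlog_sq := sq_nonneg (Real.log n)
  have hestimate : |lh - lam| / lam ≤ 1 / 2 := by
    rw [div_le_iff₀ hlam]
    nlinarith [mul_le_mul_of_nonneg_left hlog hκ, mul_nonneg hκ hlog_sq,
      mul_le_mul_of_nonneg_right hε₁ hlam.le]
  have hfavorable : IsFavorable σ ε √(ν * Real.log n) lam lh v W :=
    ⟨hn, by nlinarith, hκ, hσ.trans (sqrt_le_sqrt_mul_log ν hl), hlam, hε, hε₁, hnoise,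
      hestimate, hW, hv, hcontrol⟩
  refine (hfavorable.runsWithin hgap).mono ?_
  rw [← mul_div_assoc, ← mul_div_assoc, ← add_div]
  gcongr
  linarith

lemma runsWithin_of_isControlled {W : Matrix (Fin n) (Fin n) ℝ} (hn : 1 ≤ Real.log (Real.log n))
    (hlog : (1 + C₂) * Real.log n ^ 2 ≤ √n) (hC₂ : 0 ≤ C₂) (hε : 0 < ε) (hε₁ : ε ≤ 1)
    (hσ : σ ≤ √(ν : ℝ)) (hlam : lam ≠ 0)
    (hlarge : 2400 / ε * √((ν : ℝ) * n * Real.log n) ≤ |lam|) (hW : W.IsSymm)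
    (hv : IsUnitVector v) (hgap : HasEntryGap ε v)
    (hcontrol : IsControlled W v √(ν * Real.log n))
    (hlh : |lh - lam| ≤ C₂ * √(ν : ℝ) * Real.log n ^ (5 / 2 : ℝ)) :
    RunsWithin σ (ε / 2) (observation lam v W) lh v
      ((3 * C₂ + 45) * √(ν : ℝ) * Real.log n ^ (5 / 2 : ℝ) / |lam|) := by
  rcases lt_or_gt_of_ne hlam with hneg | hpos
  · rw [abs_of_neg hneg] at hlarge ⊢
    refine RunsWithin.of_neg ?_
    rw [← observation_neg]
    exact runsWithin_of_pos hn hlog hC₂ hε hε₁ hσ (neg_pos.2 hneg) hlarge hW.neg hv hgap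
      hcontrol.neg (by rwa [neg_sub_neg, abs_sub_comm])
  · rw [abs_of_pos hpos] at hlarge ⊢
    exact runsWithin_of_pos hn hlog hC₂ hε hε₁ hσ hpos hlarge hW hv hgap hcontrol hlh

lemma IsSubgaussianNoise.measure_not_runsWithin_le {Ω : Type*} [MeasurableSpace Ω]
    {P : Measure Ω} [IsProbabilityMeasure P] {W : Ω → Matrix (Fin n) (Fin n) ℝ}
    (hW : IsSubgaussianNoise P ν W)
    (hn : 1 ≤ Real.log (Real.log n)) (hlog : (1 + C₂) * Real.log n ^ 2 ≤ √n) (hC₂ : 0 ≤ C₂)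
    (hε : 0 < ε) (hε₁ : ε ≤ 1) (hσ : σ ≤ √(ν : ℝ)) (hlam : lam ≠ 0)
    (hlarge : 2400 / ε * √((ν : ℝ) * n * Real.log n) ≤ |lam|) (hv : IsUnitVector v)
    (hgap : HasEntryGap ε v) (lamHat : Ω → ℝ) :
    P {ω | ¬ RunsWithin σ (ε / 2) (observation lam v (W ω)) (lamHat ω) v
        ((3 * C₂ + 45) * √(ν : ℝ) * Real.log n ^ (5 / 2 : ℝ) / |lam|)} ≤
      P {ω | ¬ |lamHat ω - lam| ≤ C₂ * √(ν : ℝ) * Real.log n ^ (5 / 2 : ℝ)} +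
        ENNReal.ofReal (12 * ((n : ℝ) ^ 8)⁻¹) :=
  (measure_mono fun ω => mt fun h => runsWithin_of_isControlled hn hlog hC₂ hε hε₁ hσ hlam hlarge
    (hW.symm ω) hv hgap h.2 h.1).trans
    (measure_not_and_le.trans (by gcongr; exact hW.measure_not_isControlled_le hn v))

lemma eventually_one_le_log_log_and_mul_log_sq_le (D : ℝ) :
    ∀ᶠ n : ℕ in Filter.atTop, 1 ≤ Real.log (Real.log n) ∧ D * Real.log n ^ 2 ≤ √n := by
  have hcast := tendsto_natCast_atTop_atTop (R := ℝ)
  have hloglog : ∀ᶠ n : ℕ in Filter.atTop, 1 ≤ Real.log (Real.log n) :=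
    (Real.tendsto_log_atTop.comp (Real.tendsto_log_atTop.comp hcast)).eventually_ge_atTop 1
  have hlog : ∀ᶠ n : ℕ in Filter.atTop,
      ‖D * Real.log n ^ (2 : ℝ)‖ ≤ 1 * ‖(n : ℝ) ^ (1 / 2 : ℝ)‖ :=
    hcast.eventually (((isLittleO_log_rpow_rpow_atTop 2 one_half_pos).const_mul_left D).bound
      one_pos)
  filter_upwards [hloglog, hlog] with n hn hle
  rw [one_mul, ← Real.sqrt_eq_rpow, Real.norm_of_nonneg (Real.sqrt_nonneg _), Real.rpow_two] at hle
  exact ⟨hn, (Real.le_norm_self _).trans hle⟩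

lemma ofReal_add_ofReal_le {K x l : ℝ} (hK : 0 ≤ K) (hx : 0 ≤ x) (hl : 1 ≤ l) :
    ENNReal.ofReal (K * x * l) + ENNReal.ofReal (12 * x) ≤ ENNReal.ofReal ((K + 12) * x * l) := by
  rw [← ENNReal.ofReal_add (by positivity) (by positivity)]
  exact ENNReal.ofReal_le_ofReal (by nlinarith)

end Assembly

end SpikedMatrix

theorem theorem1_general (C₂ : ℝ) (hC₂ : 0 < C₂) :
    ∃ C : ℝ, 0 < C ∧
      ∀ ε₀ C₁ K : ℝ, 0 < ε₀ → ε₀ ≤ 1 → 2400 / ε₀ < C₁ → 0 < K →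
      ∃ (K' : ℝ) (n₀ : ℕ), 0 < K' ∧ ∀ n : ℕ, n₀ ≤ n →
        ∀ (Ω : Type*) [MeasurableSpace Ω] (P : Measure Ω) [IsProbabilityMeasure P]
          (σ : ℝ) (ν : ℝ≥0) (W : Ω → Matrix (Fin n) (Fin n) ℝ)
          (lam : ℝ) (ustar : Fin n → ℝ) (lamHat : Ω → ℝ),
          σ ≤ √(ν : ℝ) →
          SpikedMatrix.IsSubgaussianNoise P ν W →
          lam ≠ 0 →
          SpikedMatrix.IsUnitVector ustar →
          SpikedMatrix.HasEntryGap ε₀ ustar →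
          C₁ * √((ν : ℝ) * n * Real.log n) ≤ |lam| →
          P {ω | ¬ |lamHat ω - lam| ≤ C₂ * √(ν : ℝ) * Real.log n ^ (5 / 2 : ℝ)}
            ≤ ENNReal.ofReal (K * ((n : ℝ) ^ 8)⁻¹ * Real.log n) →
          P {ω | ¬ SpikedMatrix.RunsWithin σ (ε₀ / 2)
                (SpikedMatrix.observation lam ustar (W ω)) (lamHat ω) ustar
                (C * √(ν : ℝ) * Real.log n ^ (5 / 2 : ℝ) / |lam|)}
            ≤ ENNReal.ofReal (K' * ((n : ℝ) ^ 8)⁻¹ * Real.log n) := by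
  refine ⟨3 * C₂ + 45, by positivity, fun ε₀ C₁ K hε hε₁ hC₁ hK => ?_⟩
  obtain ⟨n₀, hn₀⟩ := Filter.eventually_atTop.1
    (SpikedMatrix.eventually_one_le_log_log_and_mul_log_sq_le (1 + C₂))
  refine ⟨K + 12, n₀, by positivity, ?_⟩
  intro n hn Ω _ P _ σ ν W lam v lamHat hσ hW hlam hv hgap hlarge hestimate
  obtain ⟨hloglog, hlog⟩ := hn₀ n hn
  have hlarge' : 2400 / ε₀ * √((ν : ℝ) * n * Real.log n) ≤ |lam| :=
    (mul_le_mul_of_nonneg_right hC₁.le (Real.sqrt_nonneg _)).trans hlarge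
  calc _ ≤ _ + ENNReal.ofReal (12 * ((n : ℝ) ^ 8)⁻¹) :=
        hW.measure_not_runsWithin_le hloglog hlog hC₂.le hε hε₁ hσ hlam hlarge' hv hgap lamHat
    _ ≤ _ := (add_le_add_left hestimate _).trans (SpikedMatrix.ofReal_add_ofReal_le hK.le
        (by positivity) (SpikedMatrix.one_le_log_of_one_le_log_log hloglog))

theorem theorem1 (C₂ : ℝ) (hC₂ : 0 < C₂) :
    ∃ C : ℝ, 0 < C ∧
      ∀ ε₀ C₁ K : ℝ, 0 < ε₀ → ε₀ ≤ 1 → 2400 / ε₀ < C₁ → 0 < K →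
      ∃ (K' : ℝ) (n₀ : ℕ), 0 < K' ∧ ∀ n : ℕ, n₀ ≤ n →
        ∀ (Ω : Type*) [MeasurableSpace Ω] (P : Measure Ω) [IsProbabilityMeasure P]
          (σ : ℝ) (ν : ℝ≥0) (W : Ω → Matrix (Fin n) (Fin n) ℝ)
          (lam : ℝ) (ustar : Fin n → ℝ) (lamHat : Ω → ℝ),
          0 ≤ σ →
          SpikedMatrix.IsNoise P σ ν W →
          lam ≠ 0 →
          SpikedMatrix.IsUnitVector ustar →
          SpikedMatrix.HasEntryGap ε₀ ustar →
          C₁ * √((ν : ℝ) * n * Real.log n) ≤ |lam| →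
          P {ω | ¬ |lamHat ω - lam| ≤ C₂ * √(ν : ℝ) * Real.log n ^ (5 / 2 : ℝ)}
            ≤ ENNReal.ofReal (K * ((n : ℝ) ^ 8)⁻¹ * Real.log n) →
          P {ω | ¬ SpikedMatrix.RunsWithin σ (ε₀ / 2)
                (SpikedMatrix.observation lam ustar (W ω)) (lamHat ω) ustar
                (C * √(ν : ℝ) * Real.log n ^ (5 / 2 : ℝ) / |lam|)}
            ≤ ENNReal.ofReal (K' * ((n : ℝ) ^ 8)⁻¹ * Real.log n) := by
  obtain ⟨C, hC, h⟩ := theorem1_general C₂ hC₂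
  refine ⟨C, hC, fun ε₀ C₁ K hε hε₁ hC₁ hK => ?_⟩
  obtain ⟨K', n₀, hK', h⟩ := h ε₀ C₁ K hε hε₁ hC₁ hK
  exact ⟨K', n₀, hK', fun n hn Ω _ P _ σ ν W lam v lamHat _ hW hlam hv =>
    h n hn Ω P σ ν W lam v lamHat (hW.le_sqrt hv.pos) hW.isSubgaussianNoise hlam hv⟩
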